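/- There are a deterministic algorithm, a polynomial $P$ and a constant $A$ such that the following holds. Let $V=\{0,\dots,n-1\}$ be a finite set of vertices, each of which has one color in $\chi=\{c_1,\dots,c_k\}$, with color classes of arbitrary sizes. A clustering of $V$ is a partition of $V$ into nonempty clusters, and for $S\subseteq V$ let $c_i(S)$ be the number of vertices of color $c_i$ in $S$. A clustering $\mathcal F$ is fair if every cluster $F\in\mathcal F$ satisfies $c_1(F):\cdots:c_k(F)=c_1(V):\cdots:c_k(V)$. The distance $\mathrm{dist}(\mathcal C,\mathcal C')$ is the number of unordered pairs $\{u,v\}$ of vertices that lie in a common cluster in exactly one of $\mathcal C$ and $\mathcal C'$. Given $n$, $k$, the coloring and an arbitrary clustering $\mathcal C$ of $V$ (as a list of cluster labels), the algorithm halts after at most $P(n)$ steps and outputs a fair clustering $\mathcal F$ of $V$ with $$\mathrm{dist}(\mathcal C,\mathcal F)\le A\,|\chi|^{3.81}\,\mathrm{dist}(\mathcal C,\mathcal F^*),$$ where $\mathcal F^*$ is a fair clustering of $V$ closest to $\mathcal C$; that is, $\mathcal F$ is an $O(|\chi|^{3.81})$-close fair clustering to $\mathcal C$. Steps are those of a random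 access machine on natural numbers with addition and truncated subtraction, at unit cost. -/

import Mathlib

/-! ## Clusterings, fairness and distance -/

/-- A clustering of a finite vertex set `V`: a partition of `V` into nonempty clusters. -/
abbrev Clustering (V : Type*) [Fintype V] [DecidableEq V] := Finpartition (Finset.univ : Finset V)

section Clusterings

variable {V : Type*} [Fintype V] [DecidableEq V]

/-- `u` and `v` lie in the same cluster of `C`. -/
def Clustering.Together (C : Clustering V) (u v : V) : Prop := ∃ S ∈ C.parts, u ∈ S ∧ v ∈ S

/-- The number of unordered pairs `{u, v}` of vertices that lie together in exactly one of the two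
clusterings. A pair of equal vertices is together in both, so it never counts. -/
noncomputable def Clustering.dist (C D : Clustering V) : ℕ :=
  {e : Sym2 V | ∃ u v, e = s(u, v) ∧
    ((C.Together u v ∧ ¬ D.Together u v) ∨ (¬ C.Together u v ∧ D.Together u v))}.ncard

/-- The number of vertices of color `i` in `S`. -/
def colorCount {χ : Type*} [DecidableEq χ] (col : V → χ) (i : χ) (S : Finset V) : ℕ :=
  (S.filter fun v => col v = i).card

/-- Every cluster has the color ratio of the whole vertex set. The equality of ratios
`c₁(S) : ⋯ : c_k(S) = c₁(V) : ⋯ : c_k(V)` is written by cross-multiplication; clusters are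
nonempty, so neither side is the zero vector. -/
def Clustering.IsFair {χ : Type*} [DecidableEq χ] (col : V → χ) (F : Clustering V) : Prop :=
  ∀ S ∈ F.parts, ∀ i j : χ,
    colorCount col i S * colorCount col j Finset.univ =
      colorCount col j S * colorCount col i Finset.univ

/-- `F` is a fair clustering at minimum distance from `C`. -/
def Clustering.IsClosestFair {χ : Type*} [DecidableEq χ] (col : V → χ) (C F : Clustering V) :
    Prop :=
  F.IsFair col ∧ ∀ F' : Clustering V, F'.IsFair col → C.dist F ≤ C.dist F'

/-- `F` is an `α`-close fair clustering to `C`. -/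
def Clustering.IsCloseFair {χ : Type*} [DecidableEq χ] (col : V → χ) (α : ℝ)
    (C F : Clustering V) : Prop :=
  F.IsFair col ∧
    ∃ Fopt : Clustering V, C.IsClosestFair col Fopt ∧ (C.dist F : ℝ) ≤ α * (C.dist Fopt : ℝ)

end Clusterings

/-! ## Random access machine

Structured programs over natural-number registers and arrays, with addition and truncated
subtraction as the only arithmetic and with uniform cost (one unit for each operation, test,
register access and array access). Without multiplication this machine is polynomially related to
Turing machines. -/

namespace RAM

/-- A memory: registers `reg r` and arrays `arr a`, with entries `arr a i`. -/
structure State where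
  reg : ℕ → ℕ
  arr : ℕ → ℕ → ℕ

/-- Expressions; `read a i` is the entry of array `a` at the value of `i`. -/
inductive Expr : Type
  | lit (c : ℕ) : Expr
  | reg (r : ℕ) : Expr
  | read (a : ℕ) (i : Expr) : Expr
  | add (x y : Expr) : Expr
  | sub (x y : Expr) : Expr

/-- The value of an expression (subtraction is truncated at `0`). -/
def Expr.eval (s : State) : Expr → ℕ
  | .lit c => c
  | .reg r => s.reg r
  | .read a i => s.arr a (i.eval s)
  | .add x y => x.eval s + y.eval s
  | .sub x y => x.eval s - y.eval s

/-- The number of steps needed to evaluate an expression. -/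
def Expr.cost : Expr → ℕ
  | .lit _ => 1
  | .reg _ => 1
  | .read _ i => i.cost + 1
  | .add x y => x.cost + y.cost + 1
  | .sub x y => x.cost + y.cost + 1

/-- Programs; a test succeeds if the value of the expression is not `0`. -/
inductive Cmd : Type
  | skip : Cmd
  | set (r : ℕ) (e : Expr) : Cmd
  | write (a : ℕ) (i e : Expr) : Cmd
  | seq (p q : Cmd) : Cmd
  | cond (e : Expr) (p q : Cmd) : Cmd
  | loop (e : Expr) (p : Cmd) : Cmd

/-- The memory after storing `x` in register `r`. -/
def State.setReg (s : State) (r x : ℕ) : State :=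
  { s with reg := Function.update s.reg r x }

/-- The memory after storing `x` in entry `i` of array `a`. -/
def State.setArr (s : State) (a i x : ℕ) : State :=
  { s with arr := Function.update s.arr a (Function.update (s.arr a) i x) }

/-- `Exec p s s' t`: started on the memory `s`, the program `p` halts after exactly `t` steps with
the memory `s'`. -/
inductive Exec : Cmd → State → State → ℕ → Prop
  | skip (s : State) : Exec .skip s s 1
  | set (r : ℕ) (e : Expr) (s : State) :
      Exec (.set r e) s (s.setReg r (e.eval s)) (e.cost + 1)
  | write (a : ℕ) (i e : Expr) (s : State) :
      Exec (.write a i e) s (s.setArr a (i.eval s) (e.eval s)) (i.cost + e.cost + 1)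
  | seq {p q : Cmd} {s₁ s₂ s₃ : State} {t t' : ℕ} :
      Exec p s₁ s₂ t → Exec q s₂ s₃ t' → Exec (.seq p q) s₁ s₃ (t + t')
  | cond_true {e : Expr} {p q : Cmd} {s s' : State} {t : ℕ} :
      e.eval s ≠ 0 → Exec p s s' t → Exec (.cond e p q) s s' (e.cost + 1 + t)
  | cond_false {e : Expr} {p q : Cmd} {s s' : State} {t : ℕ} :
      e.eval s = 0 → Exec q s s' t → Exec (.cond e p q) s s' (e.cost + 1 + t)
  | loop_done {e : Expr} {p : Cmd} {s : State} :
      e.eval s = 0 → Exec (.loop e p) s s (e.cost + 1)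
  | loop_step {e : Expr} {p : Cmd} {s₁ s₂ s₃ : State} {t t' : ℕ} :
      e.eval s₁ ≠ 0 → Exec p s₁ s₂ t → Exec (.loop e p) s₂ s₃ t' →
        Exec (.loop e p) s₁ s₃ (e.cost + 1 + t + t')

end RAM

/-! ## Instances as machine inputs and outputs -/

/-- `lab` describes the clustering `C` of the vertices `0, …, n - 1`: every vertex carries a cluster
label below `n`, and two vertices have the same label exactly if they lie in the same cluster. -/
def Labels {n : ℕ} (lab : Fin n → ℕ) (C : Clustering (Fin n)) : Prop :=
  (∀ v, lab v < n) ∧ ∀ u v, lab u = lab v ↔ C.Together u v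

/-- The array whose entry at each vertex `i < n` is `f i` and whose other entries are `0`. -/
def toArray {n : ℕ} (f : Fin n → ℕ) (i : ℕ) : ℕ := if h : i < n then f ⟨i, h⟩ else 0

/-- The initial memory: register `0` holds the number of vertices, register `1` the number of
colors, array `0` the colors of the vertices, array `1` their cluster labels, and everything else
is `0`. -/
def inputState {n k : ℕ} (col : Fin n → Fin k) (lab : Fin n → ℕ) : RAM.State where
  reg r := if r = 0 then n else if r = 1 then k else 0
  arr a := if a = 0 then toArray (fun v => (col v : ℕ)) else if a = 1 then toArray lab else fun _ => 0

/-- The cluster labels written by a program: the first `n` entries of array `2`. -/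
def outputLabels (n : ℕ) (s : RAM.State) : Fin n → ℕ := fun v => s.arr 2 v

/-! ## Expressions with bounded sums, and their compilation -/

/-! The bound holds with a factor 16 that does not depend on the number of colors; since `k ^ 3.81 ≥
1` for `k ≥ 1`, the power of `k` is only slack.

Let `G` be the gcd of the color class sizes, `p` the reduced color ratio and `P = ∑ p i`, so that `G
* P = n`. By `Clustering.IsFair.exists_mul` every fair cluster has color vector `a • p` with `a ≥
1`. Distances are counted vertex by vertex: the symmetric differences of the two clusters containing
`v`, summed over `v`, give twice the distance (`Clustering.sum_card_sep`). Hence a vertex in an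
input cluster with color vector `x` costs any fair clustering at least `ratioDist x p a` for some `a
≥ 1`.

The algorithm rounds the size `d D` of each input cluster to the nearest multiple `t D * P`. The `t
D` need not sum to `G`, so the budget `G` is granted greedily to large clusters first, giving `t' D
≤ t D`; any unspent budget is handed out in single units to labels with `t' D = 0`, including unused
labels. The resulting multiplicities `τ D` sum to `G`. In each color, cluster `D` keeps as many of
its vertices as `τ D • p` allows, and the others fill the vacant places in order.

Three facts bound the cost. Rounding the size is within a factor 3 of the best multiple of `p`
(`ratioDist_round_le`). Cutting `t` down to `t'` costs no more than the excess `t D * P - d D`,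
weighted by size, which every fair clustering pays as well (`greedy_cost`). A moved vertex is
charged to the cluster it leaves and the one it enters. `sum_card_symmDiff_le` combines these to `12
+ 4 = 16`.

For the machine, every quantity is a bounded sum with truncated subtraction; such expressions
compile to nested counting loops of polynomial running time (`compile_runs`). -/

namespace RAM

/-- `p` halts from `s` within `T` steps in a memory satisfying `Q`. -/
def Runs (p : Cmd) (s : State) (T : ℕ) (Q : State → Prop) : Prop :=
  ∃ s' t, Exec p s s' t ∧ t ≤ T ∧ Q s'

theorem Runs.mono {p : Cmd} {s : State} {T T' : ℕ} {Q Q' : State → Prop}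
    (h : Runs p s T Q) (hT : T ≤ T') (hQ : ∀ s', Q s' → Q' s') : Runs p s T' Q' := by
  obtain ⟨s', t, h1, h2, h3⟩ := h
  exact ⟨s', t, h1, h2.trans hT, hQ _ h3⟩

theorem Runs.seq {p q : Cmd} {s : State} {T T' : ℕ} {Q Q' : State → Prop}
    (h : Runs p s T Q) (h' : ∀ s', Q s' → Runs q s' T' Q') : Runs (.seq p q) s (T + T') Q' := by
  obtain ⟨s', t, h1, h2, h3⟩ := h
  obtain ⟨s'', t', h1', h2', h3'⟩ := h' s' h3
  exact ⟨s'', t + t', .seq h1 h1', by omega, h3'⟩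

theorem Runs.set {r : ℕ} {e : Expr} {s : State} {Q : State → Prop}
    (h : Q (s.setReg r (e.eval s))) : Runs (.set r e) s (e.cost + 1) Q :=
  ⟨_, _, .set r e s, le_rfl, h⟩

theorem Runs.write {a : ℕ} {i e : Expr} {s : State} {Q : State → Prop}
    (h : Q (s.setArr a (i.eval s) (e.eval s))) :
    Runs (.write a i e) s (i.cost + e.cost + 1) Q :=
  ⟨_, _, .write a i e s, le_rfl, h⟩

/-- A counting loop: register `r` runs from `0` to the value of register `0`. -/
theorem Runs.count {n r : ℕ} {body : Cmd} {T : ℕ} (I : ℕ → State → Prop)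
    (hI : ∀ j s, I j s → s.reg 0 = n ∧ s.reg r = j)
    (hbody : ∀ j s, j < n → I j s → Runs body s T (I (j + 1))) {s : State} (h : I 0 s) :
    Runs (.loop (.sub (.reg 0) (.reg r)) body) s (n * (T + 4) + 4) (I n) := by
  suffices H : ∀ m j s, j + m = n → I j s →
      Runs (.loop (.sub (.reg 0) (.reg r)) body) s (m * (T + 4) + 4) (I n) from
    H n 0 s (by omega) h
  intro m
  induction m with
  | zero =>
    intro j s hj hs
    obtain rfl : j = n := by omega
    obtain ⟨h1, h2⟩ := hI _ _ hs
    exact ⟨s, _, .loop_done (by simp [Expr.eval, h1, h2]), by simp [Expr.cost], hs⟩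
  | succ m ih =>
    intro j s hj hs
    obtain ⟨h1, h2⟩ := hI _ _ hs
    obtain ⟨s', t, e1, l1, hs'⟩ := hbody j s (by omega) hs
    obtain ⟨s'', t', e2, l2, hs''⟩ := ih (j + 1) s' (by omega) hs'
    refine ⟨s'', _, .loop_step (by simp only [Expr.eval, h1, h2]; omega) e1 e2, ?_, hs''⟩
    simp only [Expr.cost]
    have : (m + 1) * (T + 4) = m * (T + 4) + T + 4 := by ring
    omega

/-- Expressions over an array memory and numbered variables, with a case distinction and with
sums over `0, …, n - 1`. -/
inductive SumExpr : Type
  | lit (c : ℕ) : SumExpr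
  | var (x : ℕ) : SumExpr
  | read (a : ℕ) (i : SumExpr) : SumExpr
  | add (x y : SumExpr) : SumExpr
  | sub (x y : SumExpr) : SumExpr
  | ite (c x y : SumExpr) : SumExpr
  | sum (x : ℕ) (e : SumExpr) : SumExpr

namespace SumExpr

/-- The value of an expression; `ρ` holds the values of the variables. -/
def eval (n : ℕ) (A : ℕ → ℕ → ℕ) : SumExpr → (ℕ → ℕ) → ℕ
  | lit c, _ => c
  | var x, ρ => ρ x
  | read a i, ρ => A a (i.eval n A ρ)
  | add x y, ρ => x.eval n A ρ + y.eval n A ρ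
  | sub x y, ρ => x.eval n A ρ - y.eval n A ρ
  | ite c x y, ρ => if c.eval n A ρ = 0 then y.eval n A ρ else x.eval n A ρ
  | sum x e, ρ => ∑ j ∈ Finset.range n, e.eval n A (Function.update ρ x j)

/-- All variables of an expression are smaller than this number. -/
def top : SumExpr → ℕ
  | lit _ => 0
  | var x => x + 1
  | read _ i => i.top
  | add x y => max x.top y.top
  | sub x y => max x.top y.top
  | ite c x y => max c.top (max x.top y.top)
  | sum x e => max (x + 1) e.top

/-- The expression reads the array `a`. -/
def Reads (a : ℕ) : SumExpr → Prop
  | lit _ => False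
  | var _ => False
  | read b i => a = b ∨ i.Reads a
  | add x y => x.Reads a ∨ y.Reads a
  | sub x y => x.Reads a ∨ y.Reads a
  | ite c x y => c.Reads a ∨ x.Reads a ∨ y.Reads a
  | sum _ e => e.Reads a

/-- A program that computes the value of an expression. Register `0` holds `n`, register `x + 1`
the variable `x`; the result goes to register `b + 1`, and only the registers above `b` change. -/
def compile : SumExpr → ℕ → Cmd
  | lit c, b => .set (b + 1) (.lit c)
  | var x, b => .set (b + 1) (.reg (x + 1))
  | read a i, b => .seq (i.compile b) (.set (b + 1) (.read a (.reg (b + 1))))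
  | add x y, b => .seq (x.compile b) (.seq (y.compile (b + 1))
      (.set (b + 1) (.add (.reg (b + 1)) (.reg (b + 2)))))
  | sub x y, b => .seq (x.compile b) (.seq (y.compile (b + 1))
      (.set (b + 1) (.sub (.reg (b + 1)) (.reg (b + 2)))))
  | ite c x y, b => .seq (c.compile b) (.cond (.reg (b + 1)) (x.compile b) (y.compile b))
  | sum x e, b =>
    .seq (.set (b + 1) (.lit 0)) (.seq (.set (b + 2) (.reg (x + 1))) (.seq (.set (x + 1) (.lit 0))
      (.seq (.loop (.sub (.reg 0) (.reg (x + 1)))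
        (.seq (e.compile (b + 2)) (.seq (.set (b + 1) (.add (.reg (b + 1)) (.reg (b + 3))))
          (.set (x + 1) (.add (.reg (x + 1)) (.lit 1))))))
        (.set (x + 1) (.reg (b + 2))))))

/-- A bound for the running time of `compile`, as a polynomial in `n`. -/
noncomputable def time : SumExpr → Polynomial ℕ
  | lit _ => 2
  | var _ => 2
  | read _ i => i.time + 3
  | add x y => x.time + y.time + 4
  | sub x y => x.time + y.time + 4
  | ite c x y => c.time + x.time + y.time + 2
  | sum _ e => Polynomial.X * (e.time + 12) + 12

/-- The condition `e.top ≤ b` puts the registers of all variables at or below `b` and all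
temporaries above it, so a subexpression compiled at a larger base cannot destroy earlier results.
Only arrays that `e` reads need to agree with `A`, which permits evaluation while another array is
being overwritten. -/
theorem compile_runs (n : ℕ) (A : ℕ → ℕ → ℕ) (e : SumExpr) :
    ∀ (b : ℕ) (s : State) (ρ : ℕ → ℕ), e.top ≤ b → s.reg 0 = n →
      (∀ x < e.top, s.reg (x + 1) = ρ x) → (∀ a, e.Reads a → s.arr a = A a) →
      Runs (e.compile b) s (e.time.eval n) fun s' =>
        s'.reg (b + 1) = e.eval n A ρ ∧ (∀ r ≤ b, s'.reg r = s.reg r) ∧ s'.arr = s.arr := by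
  induction e with
  | lit c =>
    intro b s ρ _ _ _ _
    refine (Runs.set ?_).mono (by simp [time, Expr.cost]) fun _ h => h
    refine ⟨by simp [State.setReg, eval, Expr.eval], fun r hr => ?_, rfl⟩
    simp [State.setReg, show r ≠ b + 1 by omega]
  | var x =>
    intro b s ρ hb h0 hρ _
    refine (Runs.set ?_).mono (by simp [time, Expr.cost]) fun _ h => h
    refine ⟨by simp [State.setReg, eval, Expr.eval, hρ x (by simp [top])], fun r hr => ?_, rfl⟩
    simp [State.setReg, show r ≠ b + 1 by omega]
  | read a i ih =>
    intro b s ρ hb h0 hρ hA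
    have h1 := ih b s ρ hb h0 hρ (fun c hc => hA c (Or.inr hc))
    refine (h1.seq (T' := 3) (Q' := fun s' => s'.reg (b + 1) = (read a i).eval n A ρ ∧
      (∀ r ≤ b, s'.reg r = s.reg r) ∧ s'.arr = s.arr) fun s' hs' => ?_).mono
      (by simp [time]) fun _ h => h
    obtain ⟨e1, e2, e3⟩ := hs'
    refine (Runs.set ?_).mono (by simp [Expr.cost]) fun _ h => h
    refine ⟨by simp [State.setReg, eval, Expr.eval, e1, e3, hA a (Or.inl rfl)],
      fun r hr => ?_, by simp [State.setReg, e3]⟩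
    simp [State.setReg, show r ≠ b + 1 by omega, e2 r hr]
  | add x y ihx ihy =>
    intro b s ρ hb h0 hρ hA
    simp only [top, max_le_iff, lt_max_iff] at hb hρ
    have h1 := ihx b s ρ hb.1 h0 (fun v hv => hρ v (.inl hv)) (fun c hc => hA c (Or.inl hc))
    refine (h1.seq (T' := y.time.eval n + 4) (Q' := fun s' => s'.reg (b + 1) =
      (add x y).eval n A ρ ∧ (∀ r ≤ b, s'.reg r = s.reg r) ∧ s'.arr = s.arr)
      fun s' hs' => ?_).mono (by simp [time, add_assoc]) fun _ h => h
    obtain ⟨e1, e2, e3⟩ := hs'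
    have h2 := ihy (b + 1) s' ρ (by omega) ((e2 0 (by omega)).trans h0)
      (fun v hv => (e2 _ (by omega)).trans (hρ v (.inr hv)))
      (fun c hc => by rw [e3]; exact hA c (Or.inr hc))
    refine h2.seq fun s'' hs'' => ?_
    obtain ⟨f1, f2, f3⟩ := hs''
    refine (Runs.set ?_).mono (by simp [Expr.cost]) fun _ h => h
    refine ⟨by simp [State.setReg, eval, Expr.eval, f1, f2 (b + 1) le_rfl, e1],
      fun r hr => ?_, by simp [State.setReg, e3, f3]⟩
    simp [State.setReg, show r ≠ b + 1 by omega, e2 r hr, f2 r (by omega)]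
  | sub x y ihx ihy =>
    intro b s ρ hb h0 hρ hA
    simp only [top, max_le_iff, lt_max_iff] at hb hρ
    have h1 := ihx b s ρ hb.1 h0 (fun v hv => hρ v (.inl hv)) (fun c hc => hA c (Or.inl hc))
    refine (h1.seq (T' := y.time.eval n + 4) (Q' := fun s' => s'.reg (b + 1) =
      (sub x y).eval n A ρ ∧ (∀ r ≤ b, s'.reg r = s.reg r) ∧ s'.arr = s.arr)
      fun s' hs' => ?_).mono (by simp [time, add_assoc]) fun _ h => h
    obtain ⟨e1, e2, e3⟩ := hs'
    have h2 := ihy (b + 1) s' ρ (by omega) ((e2 0 (by omega)).trans h0)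
      (fun v hv => (e2 _ (by omega)).trans (hρ v (.inr hv)))
      (fun c hc => by rw [e3]; exact hA c (Or.inr hc))
    refine h2.seq fun s'' hs'' => ?_
    obtain ⟨f1, f2, f3⟩ := hs''
    refine (Runs.set ?_).mono (by simp [Expr.cost]) fun _ h => h
    refine ⟨by simp [State.setReg, eval, Expr.eval, f1, f2 (b + 1) le_rfl, e1],
      fun r hr => ?_, by simp [State.setReg, e3, f3]⟩
    simp [State.setReg, show r ≠ b + 1 by omega, e2 r hr, f2 r (by omega)]
  | ite c x y ihc ihx ihy =>
    intro b s ρ hb h0 hρ hA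
    simp only [top, max_le_iff, lt_max_iff] at hb hρ
    have h1 := ihc b s ρ hb.1 h0 (fun v hv => hρ v (.inl hv)) (fun c hc => hA c (Or.inl hc))
    refine (h1.seq (T' := x.time.eval n + y.time.eval n + 2) (Q' := fun s' => s'.reg (b + 1) =
      (ite c x y).eval n A ρ ∧ (∀ r ≤ b, s'.reg r = s.reg r) ∧ s'.arr = s.arr)
      fun s' hs' => ?_).mono (by simp [time, add_assoc]) fun _ h => h
    obtain ⟨e1, e2, e3⟩ := hs'
    by_cases hc : c.eval n A ρ = 0
    · obtain ⟨s'', t, f1, f2, f3, f4, f5⟩ := ihy b s' ρ hb.2.2 ((e2 0 (by omega)).trans h0)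
        (fun v hv => (e2 _ (by omega)).trans (hρ v (.inr (.inr hv))))
        (fun c hc => by rw [e3]; exact hA c (Or.inr (.inr hc)))
      refine ⟨s'', _, .cond_false (by simp [Expr.eval, e1, hc]) f1, ?_, by simp [eval, hc, f3],
        fun r hr => (f4 r hr).trans (e2 r hr), f5.trans e3⟩
      simp only [Expr.cost]; omega
    · obtain ⟨s'', t, f1, f2, f3, f4, f5⟩ := ihx b s' ρ hb.2.1 ((e2 0 (by omega)).trans h0)
        (fun v hv => (e2 _ (by omega)).trans (hρ v (.inr (.inl hv))))
        (fun c hc => by rw [e3]; exact hA c (Or.inr (.inl hc)))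
      refine ⟨s'', _, .cond_true (by simp [Expr.eval, e1, hc]) f1, ?_, by simp [eval, hc, f3],
        fun r hr => (f4 r hr).trans (e2 r hr), f5.trans e3⟩
      simp only [Expr.cost]; omega
  | sum x e ih =>
    intro b s ρ hb h0 hρ hA
    simp only [top, max_le_iff, lt_max_iff] at hb hρ
    -- Loop invariant: register `x + 1` is the counter, `b + 2` saves the outer value of the
    -- variable `x`, and `b + 1` accumulates the sum. The body is compiled at base `b + 2`, so its
    -- value arrives in `b + 3`.
    let I : ℕ → State → Prop := fun j s' => s'.reg 0 = n ∧ s'.reg (x + 1) = j ∧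
      s'.reg (b + 2) = s.reg (x + 1) ∧
      s'.reg (b + 1) = ∑ j ∈ Finset.range j, e.eval n A (Function.update ρ x j) ∧
      (∀ r ≤ b, r ≠ x + 1 → s'.reg r = s.reg r) ∧ s'.arr = s.arr
    have hbody : ∀ j s', j < n → I j s' → Runs (.seq (e.compile (b + 2))
        (.seq (.set (b + 1) (.add (.reg (b + 1)) (.reg (b + 3))))
          (.set (x + 1) (.add (.reg (x + 1)) (.lit 1))))) s' (e.time.eval n + (4 + 4))
        (I (j + 1)) := by
      rintro j s' - ⟨i1, i2, i3, i4, i5, i6⟩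
      refine (ih (b + 2) s' (Function.update ρ x j) (by omega) i1 (fun v hv => ?_)
        (fun c hc => by rw [i6]; exact hA c hc)).seq fun s'' ⟨f1, f2, f3⟩ => ?_
      · by_cases hvx : v = x
        · simp [hvx, i2]
        · rw [Function.update_of_ne hvx, i5 _ (by omega) (by omega), hρ v (.inr hv)]
      · refine (Runs.set (Q := fun s3 => s3 = s''.setReg (b + 1) _) rfl).seq fun s3 hs3 => ?_
        subst hs3
        refine Runs.set ?_
        refine ⟨?_, ?_, ?_, ?_, fun r hr hrx => ?_, ?_⟩
        · simp [State.setReg, f2 0, i1]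
        · simp [State.setReg, Expr.eval, show x ≠ b by omega, f2 (x + 1) (by omega), i2]
        · simp [State.setReg, show b + 1 ≠ x by omega, f2 (b + 2) le_rfl, i3]
        · simp [State.setReg, Expr.eval, show b ≠ x by omega, f1, f2 (b + 1) (by omega), i4,
            Finset.sum_range_succ]
        · simp [State.setReg, hrx, show r ≠ b + 1 by omega, f2 r (by omega), i5 r hr hrx]
        · simp [State.setReg, f3, i6]
    have hloop := fun s' => Runs.count (r := x + 1) (s := s') I (fun j s h => ⟨h.1, h.2.1⟩) hbody
    refine Runs.mono (T := 2 + (2 + (2 + (n * (e.time.eval n + (4 + 4) + 4) + 4 + 2))))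
      (Runs.seq (Runs.set (Q := fun s3 => s3 = s.setReg (b + 1) _) rfl) fun s1 h1 =>
      Runs.seq (Runs.set (Q := fun s3 => s3 = s1.setReg (b + 2) _) rfl) fun s2 h2 =>
      Runs.seq (Runs.set (Q := fun s3 => s3 = s2.setReg (x + 1) _) rfl) fun s3 h3 =>
      Runs.seq (hloop s3 ?_) fun s4 h4 => Runs.set
        (Q := fun s' => s'.reg (b + 1) = (sum x e).eval n A ρ ∧
          (∀ r ≤ b, s'.reg r = s.reg r) ∧ s'.arr = s.arr) ?_) ?_ fun _ h => h
    · subst h1 h2 h3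
      refine ⟨?_, ?_, ?_, ?_, fun r hr hrx => ?_, ?_⟩
      · simp [State.setReg, h0]
      · simp [State.setReg, Expr.eval]
      · simp [State.setReg, Expr.eval, show b + 1 ≠ x by omega, show x ≠ b by omega]
      · simp [State.setReg, Expr.eval, show b ≠ x by omega]
      · simp [State.setReg, hrx, show r ≠ b + 1 by omega, show r ≠ b + 2 by omega]
      · simp [State.setReg]
    · obtain ⟨i1, i2, i3, i4, i5, i6⟩ := h4
      refine ⟨?_, fun r hr => ?_, ?_⟩
      · simp [State.setReg, show b ≠ x by omega, i4, eval]
      · by_cases hrx : r = x + 1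
        · simp [State.setReg, Expr.eval, hrx, i3]
        · simp [State.setReg, hrx, i5 r hr hrx]
      · simp [State.setReg, i6]
    · simp only [time, Polynomial.eval_add, Polynomial.eval_mul, Polynomial.eval_X,
        Polynomial.eval_ofNat]
      ring_nf
      omega

/-- The program that fills the first `n` entries of the array `a` with the values of `e`, as a
function of the variable `0`. -/
def fill (a : ℕ) (e : SumExpr) : Cmd :=
  .seq (.set 1 (.lit 0)) (.loop (.sub (.reg 0) (.reg 1)) (.seq (e.compile (e.top + 1))
    (.seq (.write a (.reg 1) (.reg (e.top + 2))) (.set 1 (.add (.reg 1) (.lit 1))))))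

/-- A bound for the running time of `fill`. -/
noncomputable def fillTime (e : SumExpr) : Polynomial ℕ := Polynomial.X * (e.time + 11) + 6

/-- Since `e` does not read `a`, the entries already written do not influence later ones. Register
`1` is both the loop counter and the variable `0`; the base `e.top + 1` is at least `1`, which
protects it. The entries from `n` on are never touched, so `f` must agree with the old contents
there. -/
theorem fill_runs (n : ℕ) (A : ℕ → ℕ → ℕ) (a : ℕ) (e : SumExpr) (f : ℕ → ℕ)
    (ha : ¬ e.Reads a) (hf : ∀ i < n, ∀ ρ : ℕ → ℕ, ρ 0 = i → e.eval n A ρ = f i)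
    (hout : ∀ i, n ≤ i → A a i = f i) (s : State) (h0 : s.reg 0 = n) (hs : s.arr = A) :
    Runs (fill a e) s (e.fillTime.eval n) fun s' =>
      s'.reg 0 = n ∧ s'.arr = Function.update A a f := by
  let I : ℕ → State → Prop := fun j s' => s'.reg 0 = n ∧ s'.reg 1 = j ∧
    s'.arr = Function.update A a fun i => if i < j then f i else A a i
  have hbody : ∀ j s', j < n → I j s' → Runs (.seq (e.compile (e.top + 1))
    (.seq (.write a (.reg 1) (.reg (e.top + 2))) (.set 1 (.add (.reg 1) (.lit 1))))) s'
      (e.time.eval n + (3 + 4)) (I (j + 1)) := by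
    rintro j s' hj ⟨i1, i2, i3⟩
    refine (compile_runs n A e (e.top + 1) s' (fun x => s'.reg (x + 1)) (by omega) i1
      (fun _ _ => rfl) (fun c hc => ?_)).seq fun s'' ⟨f1, f2, f3⟩ => ?_
    · rw [i3, Function.update_of_ne]
      rintro rfl
      exact ha hc
    · refine (Runs.write (Q := fun s3 => s3 = s''.setArr a _ _) rfl).seq fun s3 hs3 => ?_
      subst hs3
      refine Runs.set ⟨?_, ?_, ?_⟩
      · simp [State.setReg, State.setArr, f2 0, i1]
      · simp [State.setReg, State.setArr, Expr.eval, f2 1, i2]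
      · simp only [State.setReg, State.setArr, Expr.eval, f1, f2 1 (by omega), i2, f3, i3,
          Function.update_self, Function.update_idem]
        congr 1
        funext i
        rcases eq_or_ne i j with rfl | hij
        · simp [hf i hj (fun x => s'.reg (x + 1)) i2]
        · rw [Function.update_of_ne hij]
          have : i < j + 1 ↔ i < j := by omega
          simp [this]
  refine Runs.mono (T := 2 + (n * (e.time.eval n + (3 + 4) + 4) + 4))
    (Runs.seq (Runs.set (Q := fun s3 => s3 = s.setReg 1 _) rfl) fun s1 h1 =>
      Runs.count (r := 1) I (fun j s h => ⟨h.1, h.2.1⟩) hbody ?_) ?_ ?_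
  · subst h1
    exact ⟨by simp [State.setReg, h0], by simp [State.setReg, Expr.eval],
      by simp [State.setReg, hs]⟩
  · simp only [fillTime, Polynomial.eval_add, Polynomial.eval_mul, Polynomial.eval_X,
        Polynomial.eval_ofNat]
    ring_nf
    omega
  · rintro s' ⟨i1, -, i3⟩
    refine ⟨i1, i3.trans ?_⟩
    congr 1
    funext i
    split_ifs with hi
    · rfl
    · exact hout i (by omega)

/-- `if x < y then a else b`. -/
def ifLt (x y a b : SumExpr) : SumExpr := ite (sub y x) a b

/-- `if x = y then a else b`. -/
def ifEq (x y a b : SumExpr) : SumExpr := ite (add (sub x y) (sub y x)) b a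

/-- The product of `x` and `y`, for `x ≤ n`; it uses the variable `3`. -/
def mul (x y : SumExpr) : SumExpr := sum 3 (ifLt (var 3) x y (lit 0))

variable {n : ℕ} {A : ℕ → ℕ → ℕ} {ρ : ℕ → ℕ}

theorem eval_ifLt (x y a b : SumExpr) : (ifLt x y a b).eval n A ρ =
    if x.eval n A ρ < y.eval n A ρ then a.eval n A ρ else b.eval n A ρ := by
  simp only [ifLt, eval, Nat.sub_eq_zero_iff_le]
  by_cases h : x.eval n A ρ < y.eval n A ρ
  · rw [if_pos h, if_neg (by omega)]
  · rw [if_neg h, if_pos (by omega)]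

theorem eval_ifEq (x y a b : SumExpr) : (ifEq x y a b).eval n A ρ =
    if x.eval n A ρ = y.eval n A ρ then a.eval n A ρ else b.eval n A ρ := by
  by_cases h : x.eval n A ρ = y.eval n A ρ
  · simp [ifEq, eval, h]
  · have h' : (add (sub x y) (sub y x)).eval n A ρ ≠ 0 := by simp only [eval]; omega
    rw [ifEq, eval, if_neg h', if_neg h]

/-- This is the value of `mul`, a product by repeated addition. The sum has only `n` terms, so the
first factor is cut off at `n`; this is the origin of every `min _ n` in the algorithm. -/
theorem sum_range_ite_lt (n a b : ℕ) :
    (∑ j ∈ Finset.range n, if j < a then b else 0) = min a n * b := by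
  induction n with
  | zero => simp
  | succ n ih =>
    rw [Finset.sum_range_succ, ih]
    split_ifs with h
    · rw [min_eq_right (by omega), min_eq_right (by omega)]; ring
    · rw [min_eq_left (by omega), min_eq_left (by omega)]; ring

end SumExpr

end RAM

/-! ## The greedy choice of the multiplicities -/

open Finset in
/-- The sum of `t` over the indices that precede `D` in the order of decreasing `d`. -/
def sumBefore (n : ℕ) (d t : ℕ → ℕ) (D : ℕ) : ℕ :=
  ∑ E ∈ range n, if d D < d E then t E else if d D = d E then if E < D then t E else 0 else 0

section Greedy

open Finset

variable {n : ℕ} {d t : ℕ → ℕ}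

/-- `E` precedes `D` in the order of decreasing `d`. -/
def Precedes (d : ℕ → ℕ) (E D : ℕ) : Prop := d D < d E ∨ d D = d E ∧ E < D

instance (d : ℕ → ℕ) (E D : ℕ) : Decidable (Precedes d E D) :=
  inferInstanceAs (Decidable (_ ∨ _))

theorem sumBefore_eq (n : ℕ) (d t : ℕ → ℕ) (D : ℕ) :
    sumBefore n d t D = ∑ E ∈ range n with Precedes d E D, t E := by
  rw [sumBefore, sum_filter]
  refine sum_congr rfl fun E _ => ?_
  by_cases h1 : d D < d E
  · simp [Precedes, h1]
  · by_cases h2 : d D = d E <;> by_cases h3 : E < D <;> simp [Precedes, h2, h3, h1]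

/-- Induction that always inserts the last element of the greedy order: it leaves the earlier shares
unchanged and receives what remains of `g`, up to its own demand. -/
theorem sum_greedy_filter (d t : ℕ → ℕ) (g : ℕ) (s : Finset ℕ) :
    ∑ D ∈ s, min (t D) (g - ∑ E ∈ s with Precedes d E D, t E) = min g (∑ D ∈ s, t D) := by
  induction s using Finset.induction_on_max_value
    (fun D => (toLex (OrderDual.toDual (d D), D) : Lex (ℕᵒᵈ × ℕ))) with
  | empty => simp
  | insert a s ha hmax ih =>
    have hpre : ∀ x ∈ s, Precedes d x a := by
      intro x hx
      have h := hmax x hx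
      have hne : x ≠ a := fun h => ha (h ▸ hx)
      rw [Prod.Lex.toLex_le_toLex] at h
      simp only [OrderDual.toDual_lt_toDual, OrderDual.toDual_inj] at h
      rcases h with h | h
      · exact .inl h
      · exact .inr ⟨h.1.symm, lt_of_le_of_ne h.2 hne⟩
    have hself : ¬ Precedes d a a := by simp [Precedes]
    have hnot : ∀ x ∈ s, ¬ Precedes d a x := by
      intro x hx
      have := hpre x hx
      simp only [Precedes] at this ⊢
      omega
    rw [sum_insert ha, sum_insert ha, filter_insert, if_neg hself, filter_true_of_mem hpre]
    have : ∑ D ∈ s, min (t D) (g - ∑ E ∈ insert a s with Precedes d E D, t E) =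
        ∑ D ∈ s, min (t D) (g - ∑ E ∈ s with Precedes d E D, t E) :=
      sum_congr rfl fun x hx => by rw [filter_insert, if_neg (hnot x hx)]
    rw [this, ih]
    omega

theorem sum_greedy (n : ℕ) (d t : ℕ → ℕ) (g : ℕ) :
    ∑ D ∈ range n, min (t D) (g - sumBefore n d t D) = min g (∑ D ∈ range n, t D) := by
  simp only [sumBefore_eq]
  exact sum_greedy_filter d t g (range n)

/-- A threshold argument. The removed mass `(t - t') * P` is in total at most the excess mass `t * P
- d`, and greed places it on the smallest clusters. Writing the weight `d D` as `(d D - d D₀) + d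
D₀` with the threshold `d D₀`, the first part compares termwise by sign and the second by total
mass. -/
theorem greedy_cost (n : ℕ) (d t : ℕ → ℕ) (g P : ℕ) (hN : g * P = ∑ D ∈ range n, d D) :
    ∑ D ∈ range n, (t D - min (t D) (g - sumBefore n d t D)) * P * d D ≤
      ∑ D ∈ range n, (t D * P - d D) * d D := by
  set t' := fun D => min (t D) (g - sumBefore n d t D) with ht'
  have hsum : ∑ D ∈ range n, t' D = min g (∑ D ∈ range n, t D) := sum_greedy n d t g
  have hle : ∀ D, t' D ≤ t D := fun D => min_le_left _ _
  change ∑ D ∈ range n, (t D - t' D) * P * d D ≤ _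
  by_cases hr : ∀ D ∈ range n, t D = t' D
  · rw [sum_eq_zero fun D hD => by rw [← hr D hD]; simp]
    exact Nat.zero_le _
  push Not at hr
  -- The threshold is the size of the largest cluster whose demand is cut.
  obtain ⟨D₀, hD₀, hmax⟩ := exists_max_image ((range n).filter fun D => t D ≠ t' D) d
    (by obtain ⟨D, h1, h2⟩ := hr; exact ⟨D, by simp_all⟩)
  rw [mem_filter] at hD₀
  have hlarge : ∀ D ∈ range n, d D₀ < d D → t' D = t D := by
    intro D hD h
    by_contra hne
    have := hmax D (mem_filter.2 ⟨hD, Ne.symm hne⟩)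
    omega
  -- The demand of `D₀` already exceeds the budget left to it, and `D₀` with all its predecessors
  -- comes before any smaller `D`.
  have hsmall : ∀ D ∈ range n, d D < d D₀ → t' D = 0 := by
    intro D hD h
    have h1 : g - sumBefore n d t D₀ < t D₀ := by
      have := hD₀.2
      simp only [ht'] at this
      omega
    have h2 : sumBefore n d t D₀ + t D₀ ≤ sumBefore n d t D := by
      rw [sumBefore_eq, sumBefore_eq, add_comm, ← sum_insert (by rw [mem_filter]; simp [Precedes])]
      refine sum_le_sum_of_subset fun E hE => ?_
      simp only [mem_insert, mem_filter] at hE ⊢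
      rcases hE with rfl | hE
      · exact ⟨hD₀.1, .inl h⟩
      · exact ⟨hE.1, by simp only [Precedes] at hE ⊢; omega⟩
    simp only [ht']
    omega
  have htot : ∑ D ∈ range n, t' D = g := by
    rw [hsum, min_eq_left]
    by_contra hlt
    have h1 : ∑ D ∈ range n, t' D = ∑ D ∈ range n, t D := by omega
    exact hD₀.2 ((sum_eq_sum_iff_of_le fun D _ => hle D).1 h1 D₀ hD₀.1).symm
  -- all sums are compared with the same sums weighted by the threshold
  have key : ∀ D ∈ range n, (((t D - t' D : ℕ) * P : ℤ) - (t D * P - d D : ℕ)) * (d D - d D₀) ≤ 0 := by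
    intro D hD
    rcases lt_trichotomy (d D) (d D₀) with h | h | h
    · rw [hsmall D hD h, Nat.sub_zero]
      refine mul_nonpos_of_nonneg_of_nonpos ?_ (by omega)
      have : t D * P - d D ≤ t D * P := Nat.sub_le _ _
      have : ((t D * P - d D : ℕ) : ℤ) ≤ t D * P := by exact_mod_cast this
      linarith
    · simp [h]
    · rw [hlarge D hD h, Nat.sub_self]
      refine mul_nonpos_of_nonpos_of_nonneg ?_ (by omega)
      simp
  -- The truncated excess is at least `t * P - d`, and `∑ d = g * P = ∑ t' * P` because the budget
  -- is exhausted.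
  have hmass : ∑ D ∈ range n, (((t D - t' D : ℕ) * P : ℤ) - (t D * P - d D : ℕ)) ≤ 0 := by
    have h1 : ∀ D ∈ range n, (((t D - t' D : ℕ) * P : ℤ) - (t D * P - d D : ℕ)) ≤
        d D - t' D * P := by
      intro D _
      rw [Nat.cast_sub (hle D)]
      have : (t D * P : ℤ) - d D ≤ (t D * P - d D : ℕ) := by
        have : t D * P ≤ (t D * P - d D) + d D := by omega
        have : (t D * P : ℤ) ≤ (t D * P - d D : ℕ) + d D := by exact_mod_cast this
        linarith
      nlinarith
    refine (sum_le_sum h1).trans ?_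
    rw [sum_sub_distrib, ← sum_mul]
    have h2 : (∑ D ∈ range n, (d D : ℤ)) = g * P := by exact_mod_cast hN.symm
    have h3 : (∑ D ∈ range n, (t' D : ℤ)) = g := by exact_mod_cast htot
    rw [h2, h3, sub_self]
  have hfin : ∑ D ∈ range n, (((t D - t' D : ℕ) * P : ℤ) - (t D * P - d D : ℕ)) * d D ≤ 0 := by
    have h1 := sum_nonpos key
    have h2 : ∑ D ∈ range n, (((t D - t' D : ℕ) * P : ℤ) - (t D * P - d D : ℕ)) * d D =
        ∑ D ∈ range n, (((t D - t' D : ℕ) * P : ℤ) - (t D * P - d D : ℕ)) * (d D - d D₀) +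
        (∑ D ∈ range n, (((t D - t' D : ℕ) * P : ℤ) - (t D * P - d D : ℕ))) * d D₀ := by
      rw [sum_mul, ← sum_add_distrib]
      exact sum_congr rfl fun D _ => by ring
    rw [h2]
    exact add_nonpos h1 (mul_nonpos_of_nonpos_of_nonneg hmass (by positivity))
  simp only [sub_mul, sum_sub_distrib] at hfin
  zify [hle] at hfin ⊢
  linarith

end Greedy

/-! ## The distance of a color vector to the multiples of the color ratio -/

section RatioDist

open Finset

variable {χ : Type*} [Fintype χ]

/-- The `ℓ¹`-distance of `x` to `a • p`. -/
def ratioDist (x p : χ → ℕ) (a : ℕ) : ℤ := ∑ i, |(x i : ℤ) - a * p i|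

theorem ratioDist_le (x p : χ → ℕ) (a b : ℕ) :
    ratioDist x p a ≤ ratioDist x p b + |(a : ℤ) - b| * ∑ i, (p i : ℤ) := by
  rw [ratioDist, ratioDist, mul_sum, ← sum_add_distrib]
  refine sum_le_sum fun i _ => ?_
  have h : |(a : ℤ) - b| * p i = |((b : ℤ) - a) * p i| := by
    rw [abs_mul, abs_sub_comm, abs_of_nonneg (by positivity : (0 : ℤ) ≤ p i)]
  rw [h]
  calc |(x i : ℤ) - a * p i| = |((x i : ℤ) - b * p i) + ((b : ℤ) - a) * p i| := by ring_nf
    _ ≤ _ := abs_add_le _ _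

theorem abs_sub_le_ratioDist (x p : χ → ℕ) (a : ℕ) :
    |(∑ i, (x i : ℤ)) - a * ∑ i, (p i : ℤ)| ≤ ratioDist x p a := by
  rw [mul_sum, ← sum_sub_distrib]
  exact abs_sum_le_sum_abs _ _

/-- The multiple of `P` with factor `t` is nearest to `d`. -/
theorem abs_sub_le_of_round {d t P : ℕ} (h1 : 2 * t * P ≤ 2 * d + P)
    (h2 : 2 * d < 2 * t * P + P) (b : ℕ) : |(d : ℤ) - t * P| ≤ |(d : ℤ) - b * P| := by
  zify at h1 h2
  rcases lt_trichotomy b t with h | rfl | h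
  · have : ((b : ℤ) + 1) * P ≤ t * P := by
      exact_mod_cast Nat.mul_le_mul_right P h
    rw [abs_le]
    have := le_abs_self ((d : ℤ) - b * P)
    constructor <;> nlinarith
  · exact le_rfl
  · have : ((t : ℤ) + 1) * P ≤ b * P := by
      exact_mod_cast Nat.mul_le_mul_right P h
    rw [abs_le]
    have := neg_abs_le ((d : ℤ) - b * P)
    constructor <;> nlinarith

/-- Passing from `b` to `t` changes the distance by at most `|t - b| * P ≤ |d - t * P| + |d - b * P|
≤ 2 * |d - b * P|`, and `|d - b * P|` is at most the distance to `b • p`. -/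
theorem ratioDist_round_le {x p : χ → ℕ} {d t P : ℕ} (hd : ∑ i, x i = d) (hP : ∑ i, p i = P)
    (h1 : 2 * t * P ≤ 2 * d + P) (h2 : 2 * d < 2 * t * P + P) (b : ℕ) :
    ratioDist x p t ≤ 3 * ratioDist x p b := by
  have e1 := ratioDist_le x p t b
  have e2 := abs_sub_le_ratioDist x p b
  have e3 := abs_sub_le_of_round h1 h2 b
  zify at hd hP
  rw [hP] at e1 e2
  rw [hd] at e2
  have e4 : |(t : ℤ) - b| * P ≤ |(d : ℤ) - t * P| + |(d : ℤ) - b * P| := by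
    have : |(t : ℤ) - b| * P = |((t : ℤ) - b) * P| := by
      rw [abs_mul, abs_of_nonneg (by positivity : (0 : ℤ) ≤ P)]
    rw [this]
    calc |((t : ℤ) - b) * P| = |((d : ℤ) - b * P) - ((d : ℤ) - t * P)| := by ring_nf
      _ ≤ |(d : ℤ) - b * P| + |(d : ℤ) - t * P| := abs_sub _ _
      _ = _ := add_comm _ _
  linarith

end RatioDist

/-! ## The cost of a clustering, vertex by vertex -/

section Cost

open Finset

variable {V : Type*} [Fintype V] [DecidableEq V] {χ : Type*} [Fintype χ] [DecidableEq χ]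

omit [Fintype V] [DecidableEq V] in
theorem card_eq_sum_colorCount (col : V → χ) (S : Finset V) :
    S.card = ∑ i, colorCount col i S :=
  card_eq_sum_card_fiberwise fun _ _ => mem_univ _

theorem Clustering.together_iff (C : Clustering V) (u v : V) : C.Together u v ↔ u ∈ C.part v :=
  (C.mem_part_iff_exists).symm

theorem Clustering.mem_part_comm (C : Clustering V) (u v : V) : u ∈ C.part v ↔ v ∈ C.part u := by
  simp only [← C.together_iff, Together, and_comm]

/-- The vertices whose membership in the cluster of `v` is not the same in both clusterings. -/
def Clustering.sep (C D : Clustering V) (v : V) : Finset V := symmDiff (C.part v) (D.part v)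

/-- The handshake lemma for the graph of pairs on which the clusterings disagree. -/
theorem Clustering.sum_card_sep (C D : Clustering V) : ∑ v, (C.sep D v).card = 2 * C.dist D := by
  let G : SimpleGraph V :=
    { Adj := fun u v => (C.Together u v ∧ ¬ D.Together u v) ∨ (¬ C.Together u v ∧ D.Together u v)
      symm := ⟨fun u v h => by
        simp only [together_iff] at h ⊢
        rwa [C.mem_part_comm v u, D.mem_part_comm v u]⟩
      loopless := ⟨fun v h => by
        simp [together_iff, C.mem_part (mem_univ v), D.mem_part (mem_univ v)] at h⟩ }
  classical
  have hdeg : ∀ v, G.degree v = (C.sep D v).card := by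
    intro v
    rw [← G.card_neighborFinset_eq_degree]
    congr 1
    ext u
    rw [SimpleGraph.mem_neighborFinset, G.adj_comm]
    simp only [G, together_iff, sep, mem_symmDiff]
    tauto
  have hdist : C.dist D = G.edgeFinset.card := by
    rw [dist, ← Set.ncard_coe_finset]
    congr 1
    ext e
    induction e with
    | _ a b =>
      simp only [Set.mem_ofPred_eq, SimpleGraph.coe_edgeFinset, SimpleGraph.mem_edgeSet]
      constructor
      · rintro ⟨u, v, h1, h2⟩
        have : G.Adj u v := h2
        rw [← SimpleGraph.mem_edgeSet, ← h1, SimpleGraph.mem_edgeSet] at this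
        exact this
      · exact fun h => ⟨a, b, rfl, h⟩
  rw [hdist, ← G.sum_degrees_eq_twice_card_edges]
  exact sum_congr rfl fun v _ => (hdeg v).symm

/-- The source of the lower bound at a vertex: with `B` a fair cluster, the left side is the
distance of the color vector of `A` to a multiple of the ratio. -/
theorem sum_abs_colorCount_le (col : V → χ) (A B : Finset V) :
    ∑ i, |(colorCount col i A : ℤ) - colorCount col i B| ≤ (symmDiff A B).card := by
  rw [card_eq_sum_colorCount col (symmDiff A B), Nat.cast_sum]
  refine sum_le_sum fun i _ => ?_
  have key : ∀ A B : Finset V, colorCount col i A ≤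
      colorCount col i B + colorCount col i (symmDiff A B) := by
    intro A B
    refine (card_le_card ?_).trans (card_union_le _ _)
    intro v hv
    simp only [mem_filter, mem_union, mem_symmDiff] at hv ⊢
    tauto
  have h1 := key A B
  have h2 := key B A
  rw [symmDiff_comm] at h2
  rw [abs_le]
  constructor <;> omega

/-- The vertices with label `D`. -/
def labelClass (lab : V → ℕ) (D : ℕ) : Finset V := univ.filter fun v => lab v = D

omit [DecidableEq V] in
theorem mem_labelClass {lab : V → ℕ} {D : ℕ} {v : V} : v ∈ labelClass lab D ↔ lab v = D := by
  simp [labelClass]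

theorem sum_eq_sum_labelClass {lab : V → ℕ} {n : ℕ} (h : ∀ v, lab v < n) (s : Finset V)
    (f : ℕ → ℕ) : ∑ v ∈ s, f (lab v) = ∑ D ∈ range n, (s ∩ labelClass lab D).card * f D := by
  rw [← sum_fiberwise_of_maps_to (g := lab) (t := range n) fun v _ => mem_range.2 (h v)]
  refine sum_congr rfl fun D _ => ?_
  rw [sum_congr rfl (g := fun _ => f D) fun v hv => by rw [(mem_filter.1 hv).2], sum_const,
    smul_eq_mul]
  congr 2
  ext v
  simp [mem_labelClass]

/-- The cost estimate: `lab` labels the given clustering and `out` the new one, `t D` is the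
rounded size of the input cluster `D`, `t' D` its greedy choice and `τ D` the multiplicity of the
color ratio in the new cluster `D`. The numbers `cst v` are lower bounds for the cost of any fair
clustering at `v`. -/
theorem sum_card_symmDiff_le (col : V → χ) (lab out : V → ℕ) (n : ℕ) (hlab : ∀ v, lab v < n)
    (hout : ∀ v, out v < n) (p : χ → ℕ) (P : ℕ) (hP : ∑ i, p i = P)
    (d t t' τ : ℕ → ℕ) (hd : ∀ D, d D = (labelClass lab D).card)
    (ht1 : ∀ D < n, 2 * t D * P ≤ 2 * d D + P) (ht2 : ∀ D < n, 2 * d D < 2 * t D * P + P)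
    (hτ : ∀ D < n, t' D ≤ τ D) (hτ' : ∀ D < n, τ D ≤ max (t D) 1)
    (hy : ∀ D < n, ∀ i, colorCount col i (labelClass out D) = τ D * p i)
    (hz : ∀ D < n, ∀ i, min (colorCount col i (labelClass lab D)) (τ D * p i) ≤
      colorCount col i (labelClass lab D ∩ labelClass out D))
    (hr : ∑ D ∈ range n, (t D - t' D) * P * d D ≤ ∑ D ∈ range n, (t D * P - d D) * d D)
    (cst : V → ℕ) (hcst : ∀ v, ∃ a, 1 ≤ a ∧
      ratioDist (fun i => colorCount col i (labelClass lab (lab v))) p a ≤ cst v) :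
    ∑ v, (symmDiff (labelClass lab (lab v)) (labelClass out (out v))).card ≤
      16 * ∑ v, cst v := by
  set x : ℕ → χ → ℕ := fun D i => colorCount col i (labelClass lab D) with hx
  have hxd : ∀ D, ∑ i, x D i = d D := fun D => by
    rw [hd D, card_eq_sum_colorCount col]
  have hyd : ∀ D < n, (labelClass out D).card = τ D * P := fun D hD => by
    rw [card_eq_sum_colorCount col, ← hP, mul_sum]
    exact sum_congr rfl fun i _ => hy D hD i
  set outc : ℕ → ℕ := fun D => (labelClass lab D \ labelClass out D).card with houtc
  set inc : ℕ → ℕ := fun D => (labelClass out D \ labelClass lab D).card with hinc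
  set W : ℕ → ℕ := fun D => outc D + inc D with hWdef
  -- the number of changes at `D` is the distance to the target vector
  have hW : ∀ D < n, (W D : ℤ) ≤ ratioDist (x D) p (τ D) := by
    intro D hD
    have e1 : outc D + (labelClass lab D ∩ labelClass out D).card = d D := by
      rw [hd D]; exact card_sdiff_add_card_inter _ _
    have e2 : inc D + (labelClass lab D ∩ labelClass out D).card = τ D * P := by
      rw [← hyd D hD, inter_comm]; exact card_sdiff_add_card_inter _ _
    have e3 : ∑ i, min (x D i) (τ D * p i) ≤ (labelClass lab D ∩ labelClass out D).card := by
      rw [card_eq_sum_colorCount col (_ ∩ _)]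
      exact sum_le_sum fun i _ => hz D hD i
    have e4 : ratioDist (x D) p (τ D) =
        ∑ i, ((x D i : ℤ) + τ D * p i - 2 * (min (x D i) (τ D * p i) : ℕ)) := by
      refine sum_congr rfl fun i _ => ?_
      rcases le_total (x D i) (τ D * p i) with h | h
      · rw [min_eq_left h, abs_of_nonpos (by zify at h; linarith)]; ring
      · rw [min_eq_right h, abs_of_nonneg (by zify at h; linarith)]; push_cast; ring
    rw [e4, sum_sub_distrib, sum_add_distrib, ← mul_sum, ← mul_sum]
    have h1 : ∑ i, (x D i : ℤ) = d D := by exact_mod_cast hxd D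
    have h2 : ∑ i, (p i : ℤ) = P := by exact_mod_cast hP
    rw [h1, h2]
    zify at e1 e2 e3
    simp only [hWdef]
    push_cast at e3 ⊢
    linarith
  -- the cost at a vertex
  have hτd : ∀ D < n, τ D * P ≤ d D + P := by
    intro D hD
    have h1 := ht1 D hD
    rcases le_max_iff.1 (hτ' D hD) with h | h
    · have := Nat.mul_le_mul_right P h
      nlinarith
    · have := Nat.mul_le_mul_right P h
      omega
  have hcost : ∀ v, (symmDiff (labelClass lab (lab v)) (labelClass out (out v))).card ≤
      W (lab v) + if lab v ≠ out v then d (lab v) + P + d (out v) else 0 := by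
    intro v
    split_ifs with h
    · have e : symmDiff (labelClass lab (lab v)) (labelClass out (out v)) ⊆
          labelClass lab (lab v) ∪ labelClass out (out v) := fun u hu => by
        simp only [mem_symmDiff, mem_union] at hu ⊢
        tauto
      have h1 := (card_le_card e).trans (card_union_le _ _)
      rw [← hd, hyd _ (hout v)] at h1
      have := hτd _ (hout v)
      omega
    · push Not at h
      rw [← h, symmDiff_def]
      exact (card_union_le _ _).trans (by simp [hWdef, houtc, hinc])
  -- A moved vertex is charged `d + P` at the cluster it leaves and `d` at the cluster it enters;
  -- grouping by label counts these charges `outc D` and `inc D` times.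
  have hsum : ∑ v, (symmDiff (labelClass lab (lab v)) (labelClass out (out v))).card ≤
      ∑ D ∈ range n, (d D * W D + outc D * (d D + P) + inc D * d D) := by
    refine (sum_le_sum fun v _ => hcost v).trans ?_
    rw [sum_add_distrib, sum_eq_sum_labelClass hlab univ W, ← sum_filter,
      sum_add_distrib (f := fun v => d (lab v) + P),
      sum_eq_sum_labelClass hlab _ fun D => d D + P, sum_eq_sum_labelClass hout _ d,
      ← sum_add_distrib, ← sum_add_distrib]
    refine le_of_eq (sum_congr rfl fun D _ => ?_)
    rw [univ_inter, ← hd, add_assoc]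
    congr 3
    · congr 1
      ext v
      simp only [mem_inter, mem_filter, mem_univ, true_and, mem_sdiff, mem_labelClass]
      constructor
      · rintro ⟨h1, rfl⟩; exact ⟨rfl, Ne.symm h1⟩
      · rintro ⟨rfl, h1⟩; exact ⟨Ne.symm h1, rfl⟩
    · congr 1
      ext v
      simp only [mem_inter, mem_filter, mem_univ, true_and, mem_sdiff, mem_labelClass]
      constructor
      · rintro ⟨h1, rfl⟩; exact ⟨rfl, h1⟩
      · rintro ⟨rfl, h1⟩; exact ⟨h1, rfl⟩
  -- comparison cluster by cluster
  set M : ℕ → ℕ := fun D => if t D = 0 then 4 * P else 4 * (ratioDist (x D) p (t D)).toNat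
    with hM
  have hnn : ∀ D a, 0 ≤ ratioDist (x D) p a := fun D a => sum_nonneg fun i _ => abs_nonneg _
  have hPz : ∑ i, (p i : ℤ) = P := by exact_mod_cast hP
  have hcl : ∀ D ∈ range n, d D * W D + outc D * (d D + P) + inc D * d D ≤
      d D * M D + 4 * ((t D - t' D) * P * d D) := by
    intro D hD
    rw [mem_range] at hD
    have h1 := ht1 D hD
    have h2 := ht2 D hD
    have hw := hW D hD
    have ho : outc D ≤ d D := by rw [hd]; exact card_le_card sdiff_subset
    have hi : inc D ≤ τ D * P := by rw [← hyd D hD]; exact card_le_card sdiff_subset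
    have hWD : W D = outc D + inc D := rfl
    -- If `t D = 0`, then `2 * d D < P` and the new cluster has at most `P` vertices, so the charge
    -- is at most `2 * d² + 3 * P * d ≤ 4 * P * d`. Otherwise `P ≤ 2 * d D`, and the charge is at
    -- most `4 * d D * W D`.
    by_cases h0 : t D = 0
    · simp only [hM, h0, if_true]
      rw [h0] at h1 h2
      have : τ D ≤ 1 := by have := hτ' D hD; omega
      have : τ D * P ≤ P := by have := Nat.mul_le_mul_right P this; omega
      have a1 : d D * W D ≤ d D * (d D + P) := Nat.mul_le_mul_left _ (by omega)
      have a2 : outc D * (d D + P) ≤ d D * (d D + P) := Nat.mul_le_mul_right _ ho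
      have a3 : inc D * d D ≤ P * d D := Nat.mul_le_mul_right _ (by omega)
      have a4 : d D * (2 * d D) ≤ d D * P := Nat.mul_le_mul_left _ (by omega)
      rw [Nat.zero_sub, zero_mul, zero_mul, mul_zero, add_zero]
      linarith
    · simp only [hM, h0, if_false]
      have hPd : P ≤ 2 * d D := by
        have : 1 * P ≤ t D * P := Nat.mul_le_mul_right P (by omega)
        nlinarith
      have hτt : τ D ≤ t D := by have := hτ' D hD; omega
      have hlip := ratioDist_le (x D) p (τ D) (t D)
      rw [hPz, abs_of_nonpos (by omega)] at hlip
      have hWb : W D ≤ (ratioDist (x D) p (t D)).toNat + (t D - t' D) * P := by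
        zify
        rw [Int.toNat_of_nonneg (hnn D _), Nat.cast_sub ((hτ D hD).trans hτt)]
        have : (t' D : ℤ) ≤ τ D := by exact_mod_cast hτ D hD
        have : ((t D : ℤ) - τ D) * P ≤ (t D - t' D) * P :=
          mul_le_mul_of_nonneg_right (by linarith) (by positivity)
        linarith
      have a1 : outc D * (d D + P) ≤ outc D * (3 * d D) := Nat.mul_le_mul_left _ (by omega)
      have a2 := Nat.mul_le_mul_left (4 * d D) hWb
      rw [hWD] at a2 ⊢
      nlinarith
  -- For `t = 0`, the bound `a ≥ 1` makes the fair cluster have at least `P` vertices, so its cost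
  -- at `v` exceeds `P / 2`. Otherwise the factor is `4 * 3`, by rounding.
  have hMv : ∀ v, M (lab v) ≤ 12 * cst v := by
    intro v
    obtain ⟨a, ha, hc⟩ := hcst v
    have h1 := ht1 _ (hlab v)
    have h2 := ht2 _ (hlab v)
    by_cases h0 : t (lab v) = 0
    · simp only [hM, h0, if_true]
      rw [h0] at h2
      have e := (abs_sub_le_ratioDist (x (lab v)) p a).trans hc
      have h3 : ∑ i, (x (lab v) i : ℤ) = d (lab v) := by exact_mod_cast hxd _
      rw [h3, hPz] at e
      have e' := (neg_abs_le _).trans' (neg_le_neg e)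
      have : (P : ℤ) ≤ a * P := by
        have : 1 * P ≤ a * P := Nat.mul_le_mul_right P ha
        rw [one_mul] at this
        exact_mod_cast this
      zify
      have : (2 * d (lab v) : ℤ) < P := by
        have : 2 * d (lab v) < P := by omega
        exact_mod_cast this
      linarith
    · simp only [hM, h0, if_false]
      have := ratioDist_round_le (hxd (lab v)) hP h1 h2 a
      zify
      rw [Int.toNat_of_nonneg (hnn _ _)]
      linarith
  -- The sizes alone force this: no multiple of `P` is nearer to `d` than `t * P`.
  have hev : ∀ v, t (lab v) * P - d (lab v) ≤ cst v := by
    intro v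
    obtain ⟨a, ha, hc⟩ := hcst v
    have e := (abs_sub_le_ratioDist (x (lab v)) p a).trans hc
    have h3 : ∑ i, (x (lab v) i : ℤ) = d (lab v) := by exact_mod_cast hxd _
    rw [h3, hPz] at e
    have h4 := abs_sub_le_of_round (ht1 _ (hlab v)) (ht2 _ (hlab v)) a
    have h5 := neg_abs_le ((d (lab v) : ℤ) - t (lab v) * P)
    have : (t (lab v) * P : ℤ) ≤ cst v + d (lab v) := by linarith
    have : t (lab v) * P ≤ cst v + d (lab v) := by exact_mod_cast this
    omega
  have f1 : ∑ D ∈ range n, d D * M D ≤ 12 * ∑ v, cst v := by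
    rw [mul_sum]
    refine le_trans (le_of_eq ?_) (sum_le_sum fun v _ => hMv v)
    rw [sum_eq_sum_labelClass hlab univ M]
    exact sum_congr rfl fun D _ => by rw [univ_inter, ← hd]
  have f2 : ∑ D ∈ range n, (t D * P - d D) * d D ≤ ∑ v, cst v := by
    refine le_trans (le_of_eq ?_) (sum_le_sum fun v _ => hev v)
    rw [sum_eq_sum_labelClass hlab univ fun D => t D * P - d D]
    exact sum_congr rfl fun D _ => by rw [univ_inter, ← hd, mul_comm]
  have f3 := hsum.trans (sum_le_sum hcl)
  rw [sum_add_distrib, ← mul_sum] at f3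
  linarith

end Cost

/-! ## The algorithm, as arithmetic functions of the input arrays -/

namespace FairAlg

open Finset

section Functions

variable (n : ℕ) (col lab : ℕ → ℕ)

/-- The number of vertices of the color of `v`. -/
def colorSize (v : ℕ) : ℕ := if v < n then ∑ u ∈ range n, if col u = col v then 1 else 0 else 0

/-- `1` if `j + 1` divides the size of every color class, and `0` otherwise. -/
def divides (j : ℕ) : ℕ :=
  if j < n then 1 - ∑ u ∈ range n,
    (1 - ∑ q ∈ range n, if min (q + 1) n * (j + 1) = colorSize n col u then 1 else 0) else 0

/-- The greatest common divisor of the sizes of the color classes. -/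
def gcdSize (v : ℕ) : ℕ :=
  if v < n then ∑ j ∈ range n,
    if (∑ i ∈ range n, if i < j then 0 else divides n col i) = 0 then 0 else 1 else 0

/-- The entry of the reduced color ratio for the color of `v`. -/
def ratio (v : ℕ) : ℕ :=
  if v < n then ∑ q ∈ range n,
    if colorSize n col v < min (q + 1) n * gcdSize n col v then 0 else 1 else 0

/-- The smallest size of a fair cluster. -/
def ratioSum (v : ℕ) : ℕ :=
  if v < n then ∑ q ∈ range n,
    if (∑ _i ∈ range n, 1) < min (q + 1) n * gcdSize n col v then 0 else 1 else 0

/-- The size of the input cluster with label `D`. -/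
def labelSize (D : ℕ) : ℕ := if D < n then ∑ v ∈ range n, if lab v = D then 1 else 0 else 0

/-- The size of the input cluster `D` in units of `ratioSum`, rounded. -/
def rounded (D : ℕ) : ℕ :=
  if D < n then ∑ j ∈ range n,
    if labelSize n lab D + labelSize n lab D <
      min j n * ratioSum n col D + min j n * ratioSum n col D + ratioSum n col D then 0 else 1
  else 0

/-- The greedy choice of the multiplicities, in the order of decreasing size. -/
def greedy (D : ℕ) : ℕ :=
  if D < n then rounded n col lab D - (rounded n col lab D -
    (gcdSize n col D - sumBefore n (labelSize n lab) (rounded n col lab) D)) else 0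

/-- The multiplicity of the color ratio in the output cluster `D`. -/
def target (D : ℕ) : ℕ :=
  if D < n then
    if greedy n col lab D = 0 then
      if (∑ E ∈ range n, if E < D then if greedy n col lab E = 0 then 1 else 0 else 0) <
        gcdSize n col D - ∑ E ∈ range n, greedy n col lab E then 1 else 0
    else greedy n col lab D
  else 0

/-- `1` if the vertex `v` keeps its label, and `0` otherwise. -/
def kept (v : ℕ) : ℕ :=
  if v < n then
    if (∑ u ∈ range n,
        if u < v then if lab u = lab v then if col u = col v then 1 else 0 else 0 else 0) <
      min (target n col lab (lab v)) n * ratio n col v then 1 else 0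
  else 0

/-- The number of vertices before `v` with its color that do not keep their labels. -/
def moveRank (v : ℕ) : ℕ :=
  if v < n then ∑ u ∈ range n,
    if u < v then if col u = col v then if kept n col lab u = 0 then 1 else 0 else 0 else 0
  else 0

/-- The number of vertices of the color of `v` that are missing in the cluster `D`. -/
def deficit (v D : ℕ) : ℕ :=
  min (target n col lab D) n * ratio n col v -
    ∑ u ∈ range n, if lab u = D then if col u = col v then 1 else 0 else 0

/-- The new label of the vertex `v`. -/
def newLabel (v : ℕ) : ℕ :=
  if v < n then
    if kept n col lab v = 0 then
      ∑ D ∈ range n,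
        if moveRank n col lab v < ∑ E ∈ range n, if D < E then 0 else deficit n col lab v E
          then 0 else 1
    else lab v
  else 0

/-- The final contents of the arrays. -/
def memory : ℕ → ℕ → ℕ
  | 0 => col
  | 1 => lab
  | 3 => colorSize n col
  | 4 => divides n col
  | 5 => gcdSize n col
  | 6 => ratio n col
  | 7 => ratioSum n col
  | 8 => labelSize n lab
  | 9 => rounded n col lab
  | 10 => greedy n col lab
  | 11 => target n col lab
  | 12 => kept n col lab
  | 13 => moveRank n col lab
  | _ => fun _ => 0

/-- The contents of the arrays before the array `j` is filled. -/
def stage (j a : ℕ) : ℕ → ℕ := if a < j then memory n col lab a else fun _ => 0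

theorem update_stage (j : ℕ) :
    Function.update (stage n col lab j) j (memory n col lab j) = stage n col lab (j + 1) := by
  funext a
  rcases eq_or_ne a j with rfl | h
  · simp [stage]
  · have : a < j + 1 ↔ a < j := by omega
    simp [Function.update_of_ne h, stage, this]

end Functions

/-! ## The program -/

section Program

open RAM RAM.SumExpr

/-- The defining expression of each array. -/
def code : ℕ → SumExpr
  | 2 => ite (read 12 (var 0)) (read 1 (var 0)) (sum 1 (ifLt (read 13 (var 0))
      (sum 2 (ifLt (var 1) (var 2) (lit 0)
        (sub (mul (read 11 (var 2)) (read 6 (var 0)))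
          (sum 4 (ifEq (read 1 (var 4)) (var 2)
            (ifEq (read 0 (var 4)) (read 0 (var 0)) (lit 1) (lit 0)) (lit 0))))))
      (lit 0) (lit 1)))
  | 3 => sum 1 (ifEq (read 0 (var 1)) (read 0 (var 0)) (lit 1) (lit 0))
  | 4 => sub (lit 1) (sum 1 (sub (lit 1) (sum 2
      (ifEq (mul (add (var 2) (lit 1)) (add (var 0) (lit 1))) (read 3 (var 1)) (lit 1) (lit 0)))))
  | 5 => sum 1 (ite (sum 2 (ifLt (var 2) (var 1) (lit 0) (read 4 (var 2)))) (lit 1) (lit 0))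
  | 6 => sum 1 (ifLt (read 3 (var 0)) (mul (add (var 1) (lit 1)) (read 5 (var 0))) (lit 0) (lit 1))
  | 7 => sum 1 (ifLt (sum 2 (lit 1)) (mul (add (var 1) (lit 1)) (read 5 (var 0))) (lit 0) (lit 1))
  | 8 => sum 1 (ifEq (read 1 (var 1)) (var 0) (lit 1) (lit 0))
  | 9 => sum 1 (ifLt (add (read 8 (var 0)) (read 8 (var 0)))
      (add (add (mul (var 1) (read 7 (var 0))) (mul (var 1) (read 7 (var 0)))) (read 7 (var 0)))
      (lit 0) (lit 1))
  | 10 => sub (read 9 (var 0)) (sub (read 9 (var 0)) (sub (read 5 (var 0))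
      (sum 1 (ifLt (read 8 (var 0)) (read 8 (var 1)) (read 9 (var 1))
        (ifEq (read 8 (var 0)) (read 8 (var 1)) (ifLt (var 1) (var 0) (read 9 (var 1)) (lit 0))
          (lit 0))))))
  | 11 => ite (read 10 (var 0)) (read 10 (var 0))
      (ifLt (sum 1 (ifLt (var 1) (var 0) (ite (read 10 (var 1)) (lit 0) (lit 1)) (lit 0)))
        (sub (read 5 (var 0)) (sum 1 (read 10 (var 1)))) (lit 1) (lit 0))
  | 12 => ifLt (sum 1 (ifLt (var 1) (var 0) (ifEq (read 1 (var 1)) (read 1 (var 0))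
        (ifEq (read 0 (var 1)) (read 0 (var 0)) (lit 1) (lit 0)) (lit 0)) (lit 0)))
      (mul (read 11 (read 1 (var 0))) (read 6 (var 0))) (lit 1) (lit 0)
  | 13 => sum 1 (ifLt (var 1) (var 0) (ifEq (read 0 (var 1)) (read 0 (var 0))
      (ite (read 12 (var 1)) (lit 0) (lit 1)) (lit 0)) (lit 0))
  | _ => lit 0

/-- Fill the arrays `a, …, a + j - 1`. -/
def fillFrom (a : ℕ) : ℕ → Cmd
  | 0 => .skip
  | j + 1 => .seq (fillFrom a j) (fill (a + j) (code (a + j)))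

/-- The whole algorithm. -/
def program : Cmd := .seq (fillFrom 3 11) (fill 2 (code 2))

/-- A bound for the running time of `fillFrom`. -/
noncomputable def fillFromTime (a : ℕ) : ℕ → Polynomial ℕ
  | 0 => 1
  | j + 1 => fillFromTime a j + (code (a + j)).fillTime

/-- A bound for the running time of the algorithm. -/
noncomputable def programTime : Polynomial ℕ := fillFromTime 3 11 + (code 2).fillTime

variable (n : ℕ) (col lab : ℕ → ℕ)

theorem eval_ite {A : ℕ → ℕ → ℕ} {ρ : ℕ → ℕ} (c x y : SumExpr) : (ite c x y).eval n A ρ =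
    if c.eval n A ρ = 0 then y.eval n A ρ else x.eval n A ρ := rfl

theorem eval_sum {A : ℕ → ℕ → ℕ} {ρ : ℕ → ℕ} (x : ℕ) (e : SumExpr) : (sum x e).eval n A ρ =
    ∑ j ∈ range n, e.eval n A (Function.update ρ x j) := rfl

theorem stage_of_lt {j a : ℕ} (h : a < j) : stage n col lab j a = memory n col lab a := if_pos h

/-- Each of these arrays reads only arrays of smaller number, already final at stage `j`. Variable
`0` is the index of the entry, and variable `3` is reserved for `mul`, so no capture occurs. -/
theorem eval_code (j : ℕ) (h3 : 3 ≤ j) (h13 : j < 14) (i : ℕ) (hi : i < n) (ρ : ℕ → ℕ)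
    (hρ : ρ 0 = i) : (code j).eval n (stage n col lab j) ρ = memory n col lab j i := by
  subst hρ
  interval_cases j <;>
  simp only [code, mul, eval_ifEq, eval_ifLt, eval_ite, eval_sum, eval, stage_of_lt, memory,
    Function.update_apply, Nat.reduceEqDiff, Nat.reduceLT, reduceIte, sum_range_ite_lt,
    OfNat.zero_ne_ofNat, OfNat.one_ne_ofNat, OfNat.ofNat_ne_one, zero_ne_one]
  · rw [colorSize, if_pos hi]
  · rw [divides, if_pos hi]
  · rw [gcdSize, if_pos hi]
  · rw [ratio, if_pos hi]
  · rw [ratioSum, if_pos hi]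
  · rw [labelSize, if_pos hi]
  · rw [rounded, if_pos hi]
  · rw [greedy, if_pos hi, sumBefore]
  · rw [target, if_pos hi]
  · rw [kept, if_pos hi]
  · rw [moveRank, if_pos hi]

theorem eval_code_output (i : ℕ) (hi : i < n) (ρ : ℕ → ℕ) (hρ : ρ 0 = i) :
    (code 2).eval n (stage n col lab 14) ρ = newLabel n col lab i := by
  subst hρ
  simp only [code, mul, eval_ifEq, eval_ifLt, eval_ite, eval, stage_of_lt, memory,
    Function.update_apply, Nat.reduceEqDiff, Nat.reduceLT, reduceIte, sum_range_ite_lt,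
    OfNat.zero_ne_ofNat, OfNat.one_ne_ofNat, OfNat.ofNat_ne_one, zero_ne_one]
  rw [newLabel, if_pos hi]
  simp only [deficit]
  rfl

theorem code_reads (j : ℕ) (h3 : 3 ≤ j) (h13 : j < 14) : ¬ (code j).Reads j := by
  interval_cases j <;> simp [code, Reads, mul, ifLt, ifEq]

theorem code_output_reads : ¬ (code 2).Reads 2 := by
  simp [code, Reads, mul, ifLt, ifEq]

/-- The default value `0` outside `range n` matches the entries that the program never writes. -/
theorem memory_of_le (j : ℕ) (h3 : 3 ≤ j) (h13 : j < 14) (i : ℕ) (hi : n ≤ i) :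
    memory n col lab j i = 0 := by
  have : ¬ i < n := by omega
  interval_cases j <;> simp [memory, this, colorSize, divides, gcdSize, ratio, ratioSum,
    labelSize, rounded, greedy, target, kept, moveRank]

theorem fillFrom_runs (j : ℕ) (hj : j ≤ 11) (s : State) (h0 : s.reg 0 = n)
    (hs : s.arr = stage n col lab 3) :
    Runs (fillFrom 3 j) s ((fillFromTime 3 j).eval n) fun s' =>
      s'.reg 0 = n ∧ s'.arr = stage n col lab (3 + j) := by
  induction j with
  | zero => exact ⟨s, 1, .skip s, by simp [fillFromTime], h0, hs⟩
  | succ j ih =>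
    refine ((ih (by omega)).seq fun s' hs' => fill_runs n _ (3 + j) (code (3 + j))
      (memory n col lab (3 + j)) (code_reads _ (by omega) (by omega))
      (eval_code n col lab _ (by omega) (by omega)) (fun i hi => ?_) s' hs'.1 hs'.2).mono
      (by simp [fillFromTime]) fun s' hs' => ⟨hs'.1, hs'.2.trans (update_stage n col lab _)⟩
    rw [memory_of_le n col lab _ (by omega) (by omega) i hi]
    simp [stage]

theorem program_runs (s : State) (h0 : s.reg 0 = n) (hs : s.arr = stage n col lab 3) :
    Runs program s (programTime.eval n) fun s' => s'.arr 2 = newLabel n col lab := by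
  refine ((fillFrom_runs n col lab 11 le_rfl s h0 hs).seq fun s' hs' => fill_runs n _ 2 (code 2)
    (newLabel n col lab) code_output_reads (eval_code_output n col lab) (fun i hi => ?_)
    s' hs'.1 hs'.2).mono (by simp [programTime]) fun s' hs' => by rw [hs'.2, Function.update_self]
  have : ¬ i < n := by omega
  simp [newLabel, this, stage, memory]

end Program

end FairAlg

/-! ## Counting with sums over initial segments -/

section Counting

open Finset

theorem card_fin_filter (n : ℕ) (φ : ℕ → Prop) [DecidablePred φ] :
    (univ.filter fun v : Fin n => φ v).card = ∑ u ∈ range n, if φ u then 1 else 0 := by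
  rw [card_filter, Fin.sum_univ_eq_sum_range fun u => if φ u then 1 else 0]

theorem sum_range_ite_lt_self {v n : ℕ} (h : v ≤ n) (f : ℕ → ℕ) :
    (∑ u ∈ range n, if u < v then f u else 0) = ∑ u ∈ range v, f u := by
  rw [← sum_filter]
  congr 1
  ext u
  simp only [mem_filter, mem_range]
  omega

/-- Division without a division instruction: the quotient counts the positive multiples of `g` up to
`a`. -/
theorem sum_range_ite_div {a g n : ℕ} (hg : 0 < g) (h : a / g ≤ n) :
    (∑ q ∈ range n, if a < (q + 1) * g then 0 else 1) = a / g := by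
  have : ∀ q ∈ range n, (if a < (q + 1) * g then 0 else 1) = if q < a / g then 1 else 0 := by
    intro q _
    have : q < a / g ↔ ¬ a < (q + 1) * g := by
      rw [← Nat.succ_le_iff, Nat.le_div_iff_mul_le hg, not_lt]
    by_cases h : q < a / g
    · rw [if_pos h, if_neg (this.1 h)]
    · rw [if_neg h, if_pos (not_not.1 (mt this.2 h))]
  rw [sum_congr rfl this, RAM.SumExpr.sum_range_ite_lt, min_eq_left h, mul_one]

/-- The number of elements below `n` with the property `q`. -/
def countBelow (q : ℕ → Prop) [DecidablePred q] (n : ℕ) : ℕ := ∑ u ∈ range n, if q u then 1 else 0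

/-- The elements with property `q` have the ranks `0, 1, 2, …`, each once. This one count serves the
extra units, the kept vertices and the moved vertices. -/
theorem sum_rank_window (q : ℕ → Prop) [DecidablePred q] (a b n : ℕ) :
    (∑ v ∈ range n, if q v ∧ a ≤ countBelow q v ∧ countBelow q v < b then 1 else 0) =
      min b (countBelow q n) - a := by
  induction n with
  | zero => simp [countBelow]
  | succ n ih =>
    have h : countBelow q (n + 1) = countBelow q n + if q n then 1 else 0 := sum_range_succ _ _
    rw [sum_range_succ, ih, h]
    by_cases hq : q n
    · simp only [hq, true_and, if_true]
      split_ifs <;> omega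
    · simp [hq]

/-- The number of bins that end at or before `r`, if the bin `D` occupies `[E D, E (D + 1))`. -/
def binIndex (E : ℕ → ℕ) (r n : ℕ) : ℕ := ∑ D ∈ range n, if r < E (D + 1) then 0 else 1

theorem binIndex_spec {E : ℕ → ℕ} (hE : Monotone E) {r n : ℕ} (h0 : E 0 ≤ r) :
    binIndex E r n ≤ n ∧ E (binIndex E r n) ≤ r ∧
      (binIndex E r n = n ∨ r < E (binIndex E r n + 1)) := by
  induction n with
  | zero => simpa [binIndex] using h0
  | succ n ih =>
    have h : binIndex E r (n + 1) = binIndex E r n + if r < E (n + 1) then 0 else 1 :=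
      sum_range_succ _ _
    obtain ⟨h1, h2, h3⟩ := ih
    rcases h3 with h3 | h3
    · by_cases hr : r < E (n + 1)
      · rw [h, if_pos hr, add_zero, h3]
        exact ⟨by omega, h3 ▸ h2, .inr hr⟩
      · rw [h, if_neg hr, h3]
        exact ⟨le_rfl, not_lt.1 hr, .inl rfl⟩
    · have hr : r < E (n + 1) := h3.trans_le (hE (by omega))
      rw [h, if_pos hr, add_zero]
      exact ⟨by omega, h2, .inr h3⟩

theorem binIndex_lt {E : ℕ → ℕ} (hE : Monotone E) {r n : ℕ} (h0 : E 0 ≤ r) (hn : r < E n) :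
    binIndex E r n < n := by
  obtain ⟨h1, h2, -⟩ := binIndex_spec hE (n := n) h0
  refine lt_of_le_of_ne h1 fun h => ?_
  rw [h] at h2
  omega

theorem binIndex_eq_iff {E : ℕ → ℕ} (hE : Monotone E) {r n : ℕ} (h0 : E 0 ≤ r) (hn : r < E n)
    (D : ℕ) : binIndex E r n = D ↔ E D ≤ r ∧ r < E (D + 1) := by
  obtain ⟨h1, h2, h3⟩ := binIndex_spec hE (n := n) h0
  have h4 := binIndex_lt hE h0 hn
  have h5 : r < E (binIndex E r n + 1) := h3.resolve_left h4.ne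
  constructor
  · rintro rfl
    exact ⟨h2, h5⟩
  · rintro ⟨h6, h7⟩
    rcases lt_trichotomy (binIndex E r n) D with h | h | h
    · have := hE (show binIndex E r n + 1 ≤ D from h)
      omega
    · exact h
    · have := hE (show D + 1 ≤ binIndex E r n from h)
      omega

end Counting

/-! ## The values computed by the algorithm -/

namespace FairAlg

open Finset

variable {n : ℕ} {col lab : ℕ → ℕ}

theorem colorSize_eq {v : ℕ} (hv : v < n) :
    colorSize n col v = ∑ u ∈ range n, if col u = col v then 1 else 0 := if_pos hv

theorem colorSize_pos {v : ℕ} (hv : v < n) : 0 < colorSize n col v := by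
  rw [colorSize_eq hv]
  exact sum_pos' (fun _ _ => Nat.zero_le _) ⟨v, mem_range.2 hv, by simp⟩

theorem colorSize_le (v : ℕ) : colorSize n col v ≤ n := by
  rw [colorSize]
  split_ifs
  · refine (sum_le_sum (g := fun _ => 1) fun u _ => ?_).trans (by simp)
    split_ifs <;> simp
  · exact Nat.zero_le _

theorem divides_ne_zero {j : ℕ} (hj : j < n) :
    divides n col j ≠ 0 ↔ ∀ u < n, j + 1 ∣ colorSize n col u := by
  rw [divides, if_pos hj]
  have h1 : ∀ u < n, (1 - ∑ q ∈ range n,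
      if min (q + 1) n * (j + 1) = colorSize n col u then 1 else 0) = 0 ↔
      j + 1 ∣ colorSize n col u := by
    intro u hu
    rw [Nat.sub_eq_zero_iff_le, Nat.one_le_iff_ne_zero, Ne, sum_eq_zero_iff]
    push Not
    constructor
    · rintro ⟨q, -, hq⟩
      rw [Ne, ite_eq_right_iff] at hq
      push Not at hq
      exact Dvd.intro_left _ hq.1
    · rintro ⟨c, hc⟩
      have hpos := colorSize_pos (col := col) hu
      have hle := colorSize_le (n := n) (col := col) u
      have hc0 : c ≠ 0 := by rintro rfl; omega
      have hcn : c ≤ n := by nlinarith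
      -- The cofactor satisfies `1 ≤ c ≤ n` because color sizes are positive and at most `n`; hence
      -- the search over `q + 1` finds it and the cutoff at `n` is harmless.
      refine ⟨c - 1, mem_range.2 (by omega), ?_⟩
      rw [if_pos]
      · exact one_ne_zero
      · rw [Nat.sub_add_cancel (by omega), min_eq_left hcn, hc, mul_comm]
  constructor
  · intro h u hu
    rw [← h1 u hu]
    have : ∑ u ∈ range n, (1 - ∑ q ∈ range n,
      if min (q + 1) n * (j + 1) = colorSize n col u then 1 else 0) = 0 := by omega
    exact sum_eq_zero_iff.1 this u (mem_range.2 hu)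
  · intro h
    rw [sum_eq_zero fun u hu => (h1 u (mem_range.1 hu)).2 (h u (mem_range.1 hu))]
    simp

variable {G : ℕ}

/-- The sum counts the `j` for which some common divisor `i + 1` has `i ≥ j`; these are exactly the
`j < G`. -/
theorem gcdSize_eq (hG0 : 0 < G) (hGn : G ≤ n)
    (hG : ∀ j, j ∣ G ↔ ∀ u < n, j ∣ colorSize n col u) {v : ℕ} (hv : v < n) :
    gcdSize n col v = G := by
  rw [gcdSize, if_pos hv]
  have : ∀ j ∈ range n, (if (∑ i ∈ range n, if i < j then 0 else divides n col i) = 0 then 0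
      else 1) = if j < G then 1 else 0 := by
    intro j _
    by_cases hj : j < G
    · rw [if_pos hj, if_neg]
      intro h
      have h1 := sum_eq_zero_iff.1 h (G - 1) (mem_range.2 (by omega))
      rw [if_neg (by omega)] at h1
      refine (divides_ne_zero (by omega)).2 ?_ h1
      rw [Nat.sub_add_cancel hG0]
      exact (hG G).1 dvd_rfl
    · rw [if_neg hj, if_pos]
      refine sum_eq_zero fun i hi => ?_
      split_ifs with hij
      · rfl
      · by_contra h
        have := Nat.le_of_dvd hG0 ((hG _).2 ((divides_ne_zero (mem_range.1 hi)).1 h))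
        omega
  rw [sum_congr rfl this, RAM.SumExpr.sum_range_ite_lt, min_eq_left hGn, mul_one]

theorem sum_min_succ (n : ℕ) (f : ℕ → ℕ) :
    ∑ q ∈ range n, f (min (q + 1) n) = ∑ q ∈ range n, f (q + 1) :=
  sum_congr rfl fun q hq => by rw [min_eq_left (by have := mem_range.1 hq; omega)]

theorem ratio_eq (hG0 : 0 < G) {v : ℕ} (hv : v < n) (hG : gcdSize n col v = G) :
    ratio n col v = colorSize n col v / G := by
  rw [ratio, if_pos hv, hG, sum_min_succ n fun q => if colorSize n col v < q * G then 0 else 1]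
  exact sum_range_ite_div hG0 ((Nat.div_le_self _ _).trans (colorSize_le v))

theorem ratioSum_eq (hG0 : 0 < G) {v : ℕ} (hv : v < n) (hG : gcdSize n col v = G) :
    ratioSum n col v = n / G := by
  rw [ratioSum, if_pos hv, hG, sum_const, card_range, smul_eq_mul, mul_one,
    sum_min_succ n fun q => if n < q * G then 0 else 1]
  exact sum_range_ite_div hG0 (Nat.div_le_self _ _)

theorem labelSize_le (D : ℕ) : labelSize n lab D ≤ n := by
  rw [labelSize]
  split_ifs
  · refine (sum_le_sum (g := fun _ => 1) fun u _ => ?_).trans (by simp)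
    split_ifs <;> simp
  · exact Nat.zero_le _

theorem sum_labelSize (hlab : ∀ v < n, lab v < n) : ∑ D ∈ range n, labelSize n lab D = n := by
  have : ∀ D ∈ range n, labelSize n lab D = ∑ v ∈ range n, if lab v = D then 1 else 0 :=
    fun D hD => if_pos (mem_range.1 hD)
  rw [sum_congr rfl this, sum_comm, sum_congr rfl (g := fun _ => 1) fun v hv => ?_]
  · simp
  · rw [sum_ite_eq, if_pos (mem_range.2 (hlab v (mem_range.1 hv)))]

theorem rounded_eq {P D : ℕ} (hP0 : 0 < P) (hD : D < n) (hP : ratioSum n col D = P) :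
    rounded n col lab D = (2 * labelSize n lab D + P) / (2 * P) := by
  rw [rounded, if_pos hD, hP]
  have hle := labelSize_le (n := n) (lab := lab) D
  rw [← sum_range_ite_div (n := n) (by omega)]
  · refine sum_congr rfl fun j hj => ?_
    rw [min_eq_left (mem_range.1 hj).le]
    have : labelSize n lab D + labelSize n lab D < j * P + j * P + P ↔
        2 * labelSize n lab D + P < (j + 1) * (2 * P) := by
      rw [add_mul, mul_left_comm, one_mul]; omega
    simp only [this]
  · rw [← Nat.lt_succ_iff, Nat.div_lt_iff_lt_mul (by omega), Nat.succ_eq_add_one]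
    nlinarith

theorem greedy_eq {D : ℕ} (hD : D < n) (hG : gcdSize n col D = G) :
    greedy n col lab D = min (rounded n col lab D)
      (G - sumBefore n (labelSize n lab) (rounded n col lab) D) := by
  rw [greedy, if_pos hD, hG]
  omega

theorem sum_greedy_le (hG : ∀ v < n, gcdSize n col v = G) :
    ∑ D ∈ range n, greedy n col lab D ≤ G := by
  rw [sum_congr rfl fun D hD => greedy_eq (mem_range.1 hD) (hG D (mem_range.1 hD)), sum_greedy]
  exact min_le_left _ _

/-- The vacuous bound `0 ≤ _` brings the extra units into the form of `sum_rank_window`. -/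
theorem target_eq {D : ℕ} (hD : D < n) (hG : gcdSize n col D = G) : target n col lab D =
    greedy n col lab D + if greedy n col lab D = 0 ∧
      0 ≤ countBelow (fun E => greedy n col lab E = 0) D ∧
      countBelow (fun E => greedy n col lab E = 0) D < G - ∑ E ∈ range n, greedy n col lab E
      then 1 else 0 := by
  rw [target, if_pos hD, hG, sum_range_ite_lt_self hD.le]
  by_cases h : greedy n col lab D = 0
  · simp [h, countBelow]
  · simp [h]

theorem sum_target (hGn : G ≤ n) (hG : ∀ v < n, gcdSize n col v = G) :
    ∑ D ∈ range n, target n col lab D = G := by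
  have h1 := sum_greedy_le (lab := lab) hG
  rw [sum_congr rfl fun D hD => target_eq (mem_range.1 hD) (hG D (mem_range.1 hD)),
    sum_add_distrib, sum_rank_window]
  -- There are enough labels for the unspent budget: each of the `n ≥ G` labels either has a share
  -- of at least one or is available for an extra unit.
  have h2 : n ≤ ∑ D ∈ range n, greedy n col lab D +
      countBelow (fun E => greedy n col lab E = 0) n := by
    rw [countBelow, ← sum_add_distrib]
    calc n = ∑ D ∈ range n, 1 := by simp
      _ ≤ _ := sum_le_sum fun D _ => by split_ifs <;> omega
  omega

theorem target_le (hGn : G ≤ n) (hG : ∀ v < n, gcdSize n col v = G) {D : ℕ} (hD : D < n) :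
    target n col lab D ≤ n :=
  (single_le_sum (fun _ _ => Nat.zero_le _) (mem_range.2 hD)).trans
    ((sum_target hGn hG).trans_le hGn)

/-- The number of vertices of the color of `w` in the input cluster `D`. -/
def cellSize (n : ℕ) (col lab : ℕ → ℕ) (w D : ℕ) : ℕ :=
  ∑ u ∈ range n, if lab u = D ∧ col u = col w then 1 else 0

theorem ratio_congr {u w : ℕ} (hu : u < n) (hw : w < n) (h : col u = col w)
    (hG : ∀ v < n, gcdSize n col v = G) : ratio n col u = ratio n col w := by
  rw [ratio, ratio, if_pos hu, if_pos hw, hG u hu, hG w hw, colorSize_eq hu, colorSize_eq hw, h]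

theorem deficit_eq (hGn : G ≤ n) (hG : ∀ v < n, gcdSize n col v = G) {w D : ℕ} (hD : D < n) :
    deficit n col lab w D = target n col lab D * ratio n col w - cellSize n col lab w D := by
  rw [deficit, min_eq_left (target_le hGn hG hD), cellSize]
  simp only [ite_and]

theorem kept_ne_zero (hlab : ∀ v < n, lab v < n) (hGn : G ≤ n)
    (hG : ∀ v < n, gcdSize n col v = G) {v w D : ℕ} (hv : v < n) (hw : w < n)
    (hD : lab v = D) (hc : col v = col w) : kept n col lab v ≠ 0 ↔
      countBelow (fun u => lab u = D ∧ col u = col w) v <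
        target n col lab D * ratio n col w := by
  subst hD
  rw [kept, if_pos hv, sum_range_ite_lt_self hv.le, min_eq_left (target_le hGn hG (hlab v hv)),
    ratio_congr hv hw hc hG, countBelow, hc]
  simp only [ite_and]
  split_ifs <;> simp_all

theorem sum_kept (hlab : ∀ v < n, lab v < n) (hGn : G ≤ n) (hG : ∀ v < n, gcdSize n col v = G)
    {w D : ℕ} (hw : w < n) :
    (∑ v ∈ range n, if (lab v = D ∧ col v = col w) ∧ kept n col lab v ≠ 0 then 1 else 0) =
      min (target n col lab D * ratio n col w) (cellSize n col lab w D) := by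
  have := sum_rank_window (fun u => lab u = D ∧ col u = col w) 0
    (target n col lab D * ratio n col w) n
  rw [Nat.sub_zero] at this
  refine Eq.trans ?_ this
  refine sum_congr rfl fun v hv => ?_
  by_cases h : lab v = D ∧ col v = col w
  · simp only [h, true_and, kept_ne_zero hlab hGn hG (mem_range.1 hv) hw h.1 h.2, Nat.zero_le,
      and_self]
  · simp [h]

/-- The vertex `u` has the color of `w` and does not keep its label. -/
def Moves (n : ℕ) (col lab : ℕ → ℕ) (w u : ℕ) : Prop := col u = col w ∧ kept n col lab u = 0

instance (n : ℕ) (col lab : ℕ → ℕ) (w : ℕ) : DecidablePred (Moves n col lab w) := fun _ =>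
  inferInstanceAs (Decidable (_ ∧ _))

theorem moveRank_eq {v w : ℕ} (hv : v < n) (hc : col v = col w) :
    moveRank n col lab v = countBelow (Moves n col lab w) v := by
  rw [moveRank, if_pos hv, sum_range_ite_lt_self hv.le, countBelow, hc]
  refine sum_congr rfl fun u _ => ?_
  by_cases h : col u = col w <;> simp [Moves, h]

/-- The numbering of the free places for the color of `w` starts in the cluster `D` here. -/
def binStart (n : ℕ) (col lab : ℕ → ℕ) (w D : ℕ) : ℕ := ∑ E ∈ range D, deficit n col lab w E

theorem binStart_mono (n : ℕ) (col lab : ℕ → ℕ) (w : ℕ) : Monotone (binStart n col lab w) :=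
  fun _ _ h => sum_le_sum_of_subset (range_subset_range.2 h)

/-- Free places and moved vertices balance in each color: both complement the kept vertices to the
color class, the places because the targets sum to `G` and `G * ratio` is the class size. -/
theorem count_moves (hlab : ∀ v < n, lab v < n) (hGn : G ≤ n)
    (hG : ∀ v < n, gcdSize n col v = G) {w : ℕ} (hw : w < n)
    (hr : G * ratio n col w = colorSize n col w) :
    countBelow (Moves n col lab w) n = binStart n col lab w n := by
  have h1 : ∑ D ∈ range n, min (target n col lab D * ratio n col w) (cellSize n col lab w D) +
      countBelow (Moves n col lab w) n = colorSize n col w := by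
    rw [sum_congr rfl fun D _ => (sum_kept hlab hGn hG hw).symm, sum_comm, countBelow,
      ← sum_add_distrib, colorSize_eq hw]
    refine sum_congr rfl fun v hv => ?_
    simp only [and_assoc, ite_and]
    rw [sum_ite_eq, if_pos (mem_range.2 (hlab v (mem_range.1 hv)))]
    simp only [Moves]
    by_cases hc : col v = col w <;> by_cases hk : kept n col lab v = 0 <;> simp [hc, hk]
  have h2 : ∑ D ∈ range n, min (target n col lab D * ratio n col w) (cellSize n col lab w D) +
      binStart n col lab w n = colorSize n col w := by
    rw [binStart, ← sum_add_distrib, ← hr, ← sum_target (lab := lab) hGn hG, sum_mul]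
    refine sum_congr rfl fun D hD => ?_
    rw [deficit_eq hGn hG (mem_range.1 hD)]
    omega
  omega

theorem newLabel_of_kept {v : ℕ} (hv : v < n) (h : kept n col lab v ≠ 0) :
    newLabel n col lab v = lab v := by
  rw [newLabel, if_pos hv, if_neg h]

theorem deficit_congr {v w : ℕ} (hv : v < n) (hw : w < n) (hc : col v = col w)
    (hG : ∀ v < n, gcdSize n col v = G) (D : ℕ) :
    deficit n col lab v D = deficit n col lab w D := by
  rw [deficit, deficit, ratio_congr hv hw hc hG, hc]

theorem newLabel_of_moves (hG : ∀ v < n, gcdSize n col v = G) {v w : ℕ} (hv : v < n)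
    (hw : w < n) (h : Moves n col lab w v) : newLabel n col lab v =
      binIndex (binStart n col lab w) (countBelow (Moves n col lab w) v) n := by
  rw [newLabel, if_pos hv, if_pos h.2, binIndex]
  refine sum_congr rfl fun D hD => ?_
  have : (∑ E ∈ range n, if D < E then 0 else deficit n col lab v E) =
      binStart n col lab w (D + 1) := by
    rw [binStart, ← sum_range_ite_lt_self (n := n) (mem_range.1 hD)]
    refine sum_congr rfl fun E _ => ?_
    rw [deficit_congr hv hw h.1 hG]
    split_ifs <;> first | rfl | omega
  rw [this, moveRank_eq hv h.1]

theorem countBelow_lt {q : ℕ → Prop} [DecidablePred q] {v n : ℕ} (hv : v < n) (h : q v) :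
    countBelow q v < countBelow q n := by
  have h1 : countBelow q (v + 1) = countBelow q v + if q v then 1 else 0 := sum_range_succ _ _
  have h2 : countBelow q (v + 1) ≤ countBelow q n :=
    sum_le_sum_of_subset (range_subset_range.2 hv)
  rw [if_pos h] at h1
  omega

theorem newLabel_lt (hlab : ∀ v < n, lab v < n) (hGn : G ≤ n)
    (hG : ∀ v < n, gcdSize n col v = G)
    (hr : ∀ w < n, G * ratio n col w = colorSize n col w) {v : ℕ} (hv : v < n) :
    newLabel n col lab v < n := by
  by_cases h : kept n col lab v = 0
  · have hm : Moves n col lab v v := ⟨rfl, h⟩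
    rw [newLabel_of_moves hG hv hv hm]
    refine binIndex_lt (binStart_mono n col lab v) (Nat.zero_le _) ?_
    rw [← count_moves hlab hGn hG hv (hr v hv)]
    exact countBelow_lt hv hm
  · rw [newLabel_of_kept hv h]
    exact hlab v hv

/-- Every output cluster has the target color vector. -/
theorem sum_newLabel (hlab : ∀ v < n, lab v < n) (hGn : G ≤ n)
    (hG : ∀ v < n, gcdSize n col v = G) {w D : ℕ} (hw : w < n) (hD : D < n)
    (hr : G * ratio n col w = colorSize n col w) :
    (∑ v ∈ range n, if newLabel n col lab v = D ∧ col v = col w then 1 else 0) =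
      target n col lab D * ratio n col w := by
  have h1 := sum_kept hlab hGn hG (D := D) hw
  have h2 := sum_rank_window (Moves n col lab w) (binStart n col lab w D)
    (binStart n col lab w (D + 1)) n
  have h3 : binStart n col lab w (D + 1) = binStart n col lab w D + deficit n col lab w D :=
    sum_range_succ _ _
  have h4 := binStart_mono n col lab w (show D + 1 ≤ n from hD)
  rw [count_moves hlab hGn hG hw hr, min_eq_left h4, h3, Nat.add_sub_cancel_left,
    deficit_eq hGn hG hD] at h2
  -- The new members of `D` are its kept vertices and the moved ones whose rank falls into the
  -- interval of places of `D`.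
  have h5 : (∑ v ∈ range n, if newLabel n col lab v = D ∧ col v = col w then 1 else 0) =
      min (target n col lab D * ratio n col w) (cellSize n col lab w D) +
        (target n col lab D * ratio n col w - cellSize n col lab w D) := by
    rw [← h1, ← h2, ← sum_add_distrib]
    refine sum_congr rfl fun v hv => ?_
    rw [mem_range] at hv
    by_cases hc : col v = col w
    · by_cases hk : kept n col lab v = 0
      · have hm : Moves n col lab w v := ⟨hc, hk⟩
        rw [newLabel_of_moves hG hv hw hm]
        have hlt : countBelow (Moves n col lab w) v < binStart n col lab w n := by
          rw [← count_moves hlab hGn hG hw hr]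
          exact countBelow_lt hv hm
        simp only [binIndex_eq_iff (binStart_mono n col lab w) (Nat.zero_le _) hlt, h3, hc, hk,
          deficit_eq hGn hG hD,
          hm, and_true, true_and, ne_eq, not_true_eq_false, and_false, if_false, zero_add]
      · have hm : ¬ Moves n col lab w v := fun h => hk h.2
        rw [newLabel_of_kept hv hk]
        simp [hc, hk, hm]
    · have hm : ¬ Moves n col lab w v := fun h => hc h.1
      simp [hc, hm]
  omega

end FairAlg

/-! ## Fair clusterings and the color ratio -/

section Fairness

open Finset

variable {V : Type*} [Fintype V] [DecidableEq V] {χ : Type*} [Fintype χ] [DecidableEq χ]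

/-- The greatest common divisor of the sizes of the color classes. -/
def colorGcd (col : V → χ) : ℕ := univ.gcd fun i => colorCount col i univ

/-- The reduced color ratio. -/
def reducedRatio (col : V → χ) (i : χ) : ℕ := colorCount col i univ / colorGcd col

omit [DecidableEq V] in
theorem colorGcd_mul (col : V → χ) (i : χ) :
    colorGcd col * reducedRatio col i = colorCount col i univ :=
  Nat.mul_div_cancel' (gcd_dvd (mem_univ i))

omit [Fintype V] [DecidableEq V] [Fintype χ] in
theorem colorCount_self_pos (col : V → χ) {S : Finset V} {v : V} (hv : v ∈ S) :
    0 < colorCount col (col v) S :=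
  card_pos.2 ⟨v, mem_filter.2 ⟨hv, rfl⟩⟩

omit [DecidableEq V] in
theorem colorGcd_pos [Nonempty V] (col : V → χ) : 0 < colorGcd col := by
  obtain ⟨v⟩ := ‹Nonempty V›
  refine Nat.pos_of_ne_zero fun h => ?_
  have := gcd_eq_zero_iff.1 h (col v) (mem_univ _)
  exact (colorCount_self_pos col (mem_univ v)).ne' this

/-- The clusters of a fair clustering are multiples of the reduced color ratio. -/
theorem Clustering.IsFair.exists_mul {col : V → χ} {F : Clustering V} (hF : F.IsFair col)
    (v : V) : ∃ a, 1 ≤ a ∧ ∀ i, colorCount col i (F.part v) = a * reducedRatio col i := by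
  have : Nonempty V := ⟨v⟩
  have hv : v ∈ F.part v := F.mem_part (mem_univ v)
  refine ⟨univ.gcd fun i => colorCount col i (F.part v), ?_, fun i => ?_⟩
  · refine Nat.pos_of_ne_zero fun h => ?_
    exact (colorCount_self_pos col hv).ne' (gcd_eq_zero_iff.1 h (col v) (mem_univ _))
  -- The gcd over `j` of both sides of the cross-multiplied ratio, for fixed `i`, isolates the
  -- multiplier as the gcd of the color counts of the cluster.
  · have h1 : (univ.gcd fun j => colorCount col i (F.part v) * colorCount col j univ) =
        colorCount col i (F.part v) * colorGcd col := by
      rw [Finset.gcd_mul_left, normalize_eq, colorGcd]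
    have h2 : (univ.gcd fun j => colorCount col j (F.part v) * colorCount col i univ) =
        (univ.gcd fun j => colorCount col j (F.part v)) * colorCount col i univ := by
      rw [Finset.gcd_mul_right, normalize_eq]
    have h3 := fun j => hF (F.part v) (F.part_mem.2 (mem_univ v)) i j
    simp only [h3] at h1
    rw [h2, ← colorGcd_mul col i] at h1
    refine Nat.eq_of_mul_eq_mul_right (colorGcd_pos col) ?_
    rw [← h1]
    ring

open Classical in
/-- The clustering into the classes of a labelling. -/
noncomputable def Clustering.ofLabels (out : V → ℕ) : Clustering V :=
  Finpartition.ofSetoid (Setoid.comap out ⊥)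

open Classical in
theorem Clustering.together_ofLabels (out : V → ℕ) (u v : V) :
    (ofLabels out).Together u v ↔ out u = out v := by
  rw [together_iff, ofLabels, Finpartition.mem_part_ofSetoid_iff_rel]
  exact eq_comm

theorem Clustering.part_eq_labelClass {C : Clustering V} {lab : V → ℕ}
    (h : ∀ u v, lab u = lab v ↔ C.Together u v) (v : V) :
    C.part v = labelClass lab (lab v) := by
  ext u
  rw [← together_iff, ← h, mem_labelClass]

theorem Clustering.isFair_ofLabels {col : V → χ} {out τ : V → ℕ}
    (h : ∀ v i, colorCount col i (labelClass out (out v)) = τ v * reducedRatio col i) :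
    (ofLabels out).IsFair col := by
  intro S hS i j
  obtain ⟨v, hv⟩ := (ofLabels out).nonempty_of_mem_parts hS
  have : S = labelClass out (out v) := by
    rw [← part_eq_labelClass fun u v => (together_ofLabels out u v).symm]
    exact ((ofLabels out).part_eq_of_mem hS hv).symm
  rw [this, h, h, ← colorGcd_mul, ← colorGcd_mul]
  ring

omit [Fintype χ] in
theorem Clustering.IsFair.isCloseFair {col : V → χ} {C F : Clustering V} {α : ℝ}
    (hF : F.IsFair col)
    (h : ∀ F' : Clustering V, F'.IsFair col → (C.dist F : ℝ) ≤ α * (C.dist F' : ℝ)) :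
    C.IsCloseFair col α F := by
  classical
  have hex : ∃ m, ∃ F' : Clustering V, F'.IsFair col ∧ C.dist F' = m := ⟨_, F, hF, rfl⟩
  obtain ⟨F', hF', hm⟩ := Nat.find_spec hex
  exact ⟨hF, F', ⟨hF', fun F'' hF'' => hm.trans_le (Nat.find_min' hex ⟨F'', hF'', rfl⟩)⟩, h F' hF'⟩

end Fairness

/-! ## Correctness of the algorithm -/

namespace FairAlg

open Finset

variable {n k : ℕ} (col : Fin n → Fin k) (lab : Fin n → ℕ)

/-- The labels computed by the algorithm. -/
def output : Fin n → ℕ := fun v => newLabel n (toArray fun v => (col v : ℕ)) (toArray lab) v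

theorem toArray_apply (f : Fin n → ℕ) (v : Fin n) : toArray f v = f v := by simp [toArray]

theorem colorCount_labelClass (f : ℕ → ℕ) (D : ℕ) (w : Fin n) :
    colorCount col (col w) (labelClass (fun v : Fin n => f v) D) = ∑ u ∈ range n,
      if f u = D ∧ toArray (fun v => (col v : ℕ)) u = toArray (fun v => (col v : ℕ)) w
        then 1 else 0 := by
  rw [colorCount, labelClass, filter_filter, ← card_fin_filter]
  congr 1
  ext v
  simp [toArray_apply, Fin.ext_iff]

theorem colorSize_toArray (w : Fin n) :
    colorSize n (toArray fun v => (col v : ℕ)) w = colorCount col (col w) univ := by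
  rw [colorSize_eq w.2, colorCount, ← card_fin_filter]
  congr 1
  ext v
  simp [toArray_apply, Fin.ext_iff]

theorem colorCount_eq_zero {i : Fin k} (hi : ∀ v, col v ≠ i) (S : Finset (Fin n)) :
    colorCount col i S = 0 := by
  rw [colorCount, card_eq_zero, filter_eq_empty_iff]
  exact fun v _ => hi v

theorem output_spec (hn : 0 < n) (hlab : ∀ v, lab v < n) (C : Clustering (Fin n))
    (hC : ∀ u v, lab u = lab v ↔ C.Together u v) :
    (∀ v, output col lab v < n) ∧ (Clustering.ofLabels (output col lab)).IsFair col ∧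
      ∀ F : Clustering (Fin n), F.IsFair col →
        C.dist (Clustering.ofLabels (output col lab)) ≤ 16 * C.dist F := by
  have : Nonempty (Fin n) := ⟨⟨0, hn⟩⟩
  set cA : ℕ → ℕ := toArray fun v => (col v : ℕ) with hcA
  set lA : ℕ → ℕ := toArray lab with hlA
  set G := colorGcd col with hGdef
  set p := reducedRatio col with hp
  have hlA' : ∀ v < n, lA v < n := fun v hv => by
    have := hlab ⟨v, hv⟩
    rwa [← toArray_apply lab ⟨v, hv⟩] at this
  have hG0 : 0 < G := colorGcd_pos col
  have hcs : ∀ v (hv : v < n), colorSize n cA v = colorCount col (col ⟨v, hv⟩) univ :=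
    fun v hv => colorSize_toArray col ⟨v, hv⟩
  have hdvd : ∀ j, j ∣ G ↔ ∀ u < n, j ∣ colorSize n cA u := by
    intro j
    rw [hGdef, colorGcd, Finset.dvd_gcd_iff]
    constructor
    · intro h u hu
      rw [hcs u hu]
      exact h _ (mem_univ _)
    · intro h i _
      -- The program sees only colors that occur on a vertex; an absent color has count `0` and does
      -- not affect the gcd.
      by_cases hi : ∃ v, col v = i
      · obtain ⟨v, rfl⟩ := hi
        rw [← hcs v v.2]
        exact h v v.2
      · push Not at hi
        rw [colorCount_eq_zero col hi]
        exact dvd_zero j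
  have hGn : G ≤ n := (Nat.le_of_dvd (colorSize_pos hn) ((hdvd G).1 dvd_rfl 0 hn)).trans
    (colorSize_le 0)
  have hG : ∀ v < n, gcdSize n cA v = G := fun v hv => gcdSize_eq hG0 hGn hdvd hv
  have hratio : ∀ v : Fin n, ratio n cA v = p (col v) := fun v => by
    rw [ratio_eq hG0 v.2 (hG v v.2), hcs v v.2]; rfl
  have hGr : ∀ w < n, G * ratio n cA w = colorSize n cA w := fun w hw => by
    rw [hratio ⟨w, hw⟩, hcs w hw]; exact colorGcd_mul col _
  have hGP : G * ∑ i, p i = n := by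
    rw [mul_sum, sum_congr rfl fun i _ => colorGcd_mul col i, ← card_eq_sum_colorCount, card_univ,
      Fintype.card_fin]
  set P := ∑ i, p i with hP
  have hP0 : 0 < P := Nat.pos_of_ne_zero fun h => by rw [h] at hGP; omega
  have hPs : ∀ v < n, ratioSum n cA v = P := fun v hv => by
    rw [ratioSum_eq hG0 hv (hG v hv), ← hGP, Nat.mul_div_cancel_left _ hG0]
  have hout : ∀ v, output col lab v < n := fun v => newLabel_lt hlA' hGn hG hGr v.2
  have hx : ∀ D (w : Fin n), colorCount col (col w) (labelClass lab D) =
      cellSize n cA lA w D := fun D w => by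
    have e : labelClass (fun v : Fin n => lA v) D = labelClass lab D := by
      simp only [hlA, toArray_apply]
    rw [← e]
    exact colorCount_labelClass col lA D w
  have hy : ∀ D < n, ∀ i, colorCount col i (labelClass (output col lab) D) =
      target n cA lA D * p i := by
    intro D hD i
    by_cases hi : ∃ v, col v = i
    · obtain ⟨w, rfl⟩ := hi
      rw [← hratio w, ← sum_newLabel hlA' hGn hG w.2 hD (hGr w w.2)]
      exact colorCount_labelClass col (newLabel n cA lA) D w
    · push Not at hi
      simp [colorCount_eq_zero col hi, hp, reducedRatio]
  have hz : ∀ D < n, ∀ i, min (colorCount col i (labelClass lab D)) (target n cA lA D * p i) ≤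
      colorCount col i (labelClass lab D ∩ labelClass (output col lab) D) := by
    intro D hD i
    by_cases hi : ∃ v, col v = i
    · obtain ⟨w, rfl⟩ := hi
      rw [hx, ← hratio w, min_comm, ← sum_kept hlA' hGn hG w.2, ← card_fin_filter]
      refine card_le_card fun v hv => ?_
      simp only [mem_filter, mem_univ, true_and, mem_inter, mem_labelClass] at hv ⊢
      obtain ⟨⟨h1, h2⟩, h3⟩ := hv
      have h4 : output col lab v = lab v :=
        (newLabel_of_kept v.2 h3).trans (toArray_apply lab v)
      rw [hlA, toArray_apply] at h1
      rw [hcA, toArray_apply, toArray_apply] at h2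
      exact ⟨⟨h1, h4.trans h1⟩, Fin.ext h2⟩
    · push Not at hi
      simp [colorCount_eq_zero col hi]
  have hd : ∀ D < n, labelSize n lA D = (labelClass lab D).card := fun D hD => by
    rw [labelSize, if_pos hD, labelClass, ← card_fin_filter]
    simp only [hlA, toArray_apply]
  set d : ℕ → ℕ := fun D => (labelClass lab D).card with hd'
  have ht : ∀ D < n, rounded n cA lA D = (2 * d D + P) / (2 * P) := fun D hD => by
    rw [rounded_eq hP0 hD (hPs D hD), hd D hD]
  have hr : ∑ D ∈ range n, (rounded n cA lA D - greedy n cA lA D) * P * d D ≤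
      ∑ D ∈ range n, (rounded n cA lA D * P - d D) * d D := by
    have h := greedy_cost n (labelSize n lA) (rounded n cA lA) G P
      (by rw [sum_labelSize hlA', hGP])
    refine le_trans (le_of_eq ?_) (h.trans (le_of_eq ?_))
    · exact sum_congr rfl fun D hD => by
        rw [greedy_eq (mem_range.1 hD) (hG D (mem_range.1 hD)), hd D (mem_range.1 hD)]
    · exact sum_congr rfl fun D hD => by rw [hd D (mem_range.1 hD)]
  have hgr : ∀ D < n, greedy n cA lA D ≤ rounded n cA lA D := fun D hD => by
    rw [greedy_eq hD (hG D hD)]; exact min_le_left _ _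
  refine ⟨hout, Clustering.isFair_ofLabels fun v i => hy _ (hout v) i, fun F hF => ?_⟩
  have key := sum_card_symmDiff_le col lab (output col lab) n hlab hout p P rfl d
    (rounded n cA lA) (greedy n cA lA) (target n cA lA) (fun _ => rfl)
    (fun D hD => by
      rw [ht D hD]
      have := Nat.div_mul_le_self (2 * d D + P) (2 * P)
      calc _ = (2 * d D + P) / (2 * P) * (2 * P) := by ring
        _ ≤ _ := this)
    (fun D hD => by
      rw [ht D hD]
      have := Nat.lt_div_mul_add (a := 2 * d D + P) (show 0 < 2 * P by omega)
      have e : 2 * ((2 * d D + P) / (2 * P)) * P = (2 * d D + P) / (2 * P) * (2 * P) := by ring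
      rw [e]
      omega)
    (fun D hD => by rw [target_eq hD (hG D hD)]; exact Nat.le_add_right _ _)
    (fun D hD => by
      rw [target_eq hD (hG D hD)]
      have := hgr D hD
      split_ifs with h
      · rw [h.1]; exact le_max_right _ _
      · exact this.trans (le_max_left _ _))
    hy hz hr (fun v => (C.sep F v).card) (fun v => by
      obtain ⟨a, ha, h⟩ := hF.exists_mul v
      refine ⟨a, ha, le_trans (le_of_eq ?_)
        (sum_abs_colorCount_le col (C.part v) (F.part v))⟩
      rw [ratioDist, Clustering.part_eq_labelClass hC]
      exact sum_congr rfl fun i _ => by rw [h i]; push_cast; rfl)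
  have e1 := C.sum_card_sep (Clustering.ofLabels (output col lab))
  have e2 := C.sum_card_sep F
  have e3 : ∑ v, (symmDiff (labelClass lab (lab v))
      (labelClass (output col lab) (output col lab v))).card =
      ∑ v, (C.sep (Clustering.ofLabels (output col lab)) v).card :=
    sum_congr rfl fun v _ => by
      rw [Clustering.sep, Clustering.part_eq_labelClass hC,
        Clustering.part_eq_labelClass fun u v => (Clustering.together_ofLabels _ u v).symm]
  rw [e3, e1, e2] at key
  omega

theorem inputState_arr : (inputState col lab).arr =
    stage n (toArray fun v => (col v : ℕ)) (toArray lab) 3 := by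
  funext a
  simp only [inputState, stage]
  match a with
  | 0 => rfl
  | 1 => rfl
  | 2 => rfl
  | a + 3 => simp

end FairAlg

theorem mainTheorem7 :
    ∃ (prog : RAM.Cmd) (A : ℝ) (P : Polynomial ℕ),
      ∀ (n k : ℕ) (col : Fin n → Fin k) (C : Clustering (Fin n)) (lab : Fin n → ℕ),
        Labels lab C →
          ∃ (s : RAM.State) (t : ℕ),
            RAM.Exec prog (inputState col lab) s t ∧ t ≤ P.eval n ∧
              ∃ F : Clustering (Fin n), Labels (outputLabels n s) F ∧
                C.IsCloseFair col (A * (k : ℝ) ^ (3.81 : ℝ)) F := by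
  refine ⟨FairAlg.program, 16, FairAlg.programTime, fun n k col C lab hL => ?_⟩
  obtain ⟨s, t, hexec, ht, hs⟩ := FairAlg.program_runs n (toArray fun v => (col v : ℕ))
    (toArray lab) (inputState col lab) rfl (FairAlg.inputState_arr col lab)
  have hout : outputLabels n s = FairAlg.output col lab := by
    funext v
    rw [outputLabels, hs, FairAlg.output]
  refine ⟨s, t, hexec, ht, Clustering.ofLabels (FairAlg.output col lab), ?_⟩
  rw [hout]
  rcases Nat.eq_zero_or_pos n with rfl | hn
  -- Without vertices `k` may be `0`, so the factor `k ^ 3.81` may vanish; all distances are `0`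
  -- then.
  · have hdist : ∀ F : Clustering (Fin 0), C.dist F = 0 := fun F => by
      have := C.sum_card_sep F
      rw [Finset.univ_eq_empty, Finset.sum_empty] at this
      omega
    refine ⟨⟨fun v => v.elim0, fun v => v.elim0⟩, Clustering.IsFair.isCloseFair
      (Clustering.isFair_ofLabels (τ := fun _ => 0) fun v => v.elim0) fun F' _ => ?_⟩
    simp [hdist]
  · obtain ⟨h1, h2, h3⟩ := FairAlg.output_spec col lab hn hL.1 C hL.2
    refine ⟨⟨h1, fun u v => (Clustering.together_ofLabels _ u v).symm⟩,
      h2.isCloseFair fun F' hF' => ?_⟩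
    have hk : (1 : ℝ) ≤ (k : ℝ) ^ (3.81 : ℝ) := by
      refine Real.one_le_rpow ?_ (by norm_num)
      exact_mod_cast (Fin.pos (col ⟨0, hn⟩) : 0 < k)
    have h4 : (C.dist (Clustering.ofLabels (FairAlg.output col lab)) : ℝ) ≤ 16 * C.dist F' := by
      exact_mod_cast h3 F' hF'
    refine h4.trans (mul_le_mul_of_nonneg_right ?_ (Nat.cast_nonneg _))
    linarith
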